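/- Let $\mathcal A$ be a complex Hopf *-algebra (for instance the polynomial functions on a compact matrix quantum group $G$) and $\Gamma$ a bicovariant first-order *-calculus over it, with left-invariant part $\Gamma_{inv}$, adjoint action $\varpi\colon\Gamma_{inv}\to\Gamma_{inv}\otimes\mathcal A$, and universal differential envelope $\Gamma^\wedge=\Gamma^\otimes/S^\wedge$, where $S^\wedge$ is the ideal generated by the elements $\sum_k da_k\,db_k$ with $\sum_k a_k\,db_k=0$. In all graded-differential *-algebras $d$ commutes with $*$ and $(xy)^*=(-1)^{\partial x\partial y}y^*x^*$. Let $P=(\mathcal B,i,F)$ be a quantum principal $G$-bundle over a quantum space $M$, and let $\Omega(P)$ be a graded-differential *-algebra generated by $\Omega^0(P)=\mathcal B$ as a differential algebra, such that $F$ extends to a homomorphism of graded-differential *-algebras $\widehat F\colon\Omega(P)\to\Omega(P)\mathbin{\widehat\otimes}\Gamma^\wedge$. Put $F^\wedge=(\mathrm{id}\otimes p_*)\widehat F$ with $p_*\colon\Gamma^\wedge\to\mathcal A$ the projection onto degree $0$, $\mathrm{hor}(P)=\widehat F^{-1}(\Omega(P)\otimes\mathcal A)$, $\Omega(M)=\{x\in\Omega(P):\widehat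 F(x)=x\otimes1\}$, and let $H(M)$ be the cohomology algebra of $(\Omega(M),d)$ with the involution $[x]^*=[x^*]$. A connection is a linear map $\omega\colon\Gamma_{inv}\to\Omega^1(P)$ with $\omega(\vartheta^*)=\omega(\vartheta)^*$ and $\widehat F\omega(\vartheta)=\sum_k\omega(\vartheta_k)\otimes c_k+1\otimes\vartheta$, where $\varpi(\vartheta)=\sum_k\vartheta_k\otimes c_k$. A pseudotensorial $n$-form is a linear map $\varphi\colon\Gamma_{inv}\to\Omega^n(P)$ with $F^\wedge\varphi=(\varphi\otimes\mathrm{id})\varpi$; write $\partial\varphi=n$. Let $\delta\colon\Gamma_{inv}\to\Gamma_{inv}\otimes\Gamma_{inv}$ be an embedded differential: a linear map that intertwines the adjoint actions, is hermitian for $(\vartheta\otimes\eta)^*=-\eta^*\otimes\vartheta^*$, and satisfies $d\vartheta=\sum\vartheta^1\vartheta^2$ in $\Gamma^\wedge$ whenever $\delta(\vartheta)=\sum\vartheta^1\otimes\vartheta^2$. Put $\langle\varphi,\psi\rangle(\vartheta)=\sum\varphi(\vartheta^1)\psi(\vartheta^2)$ and $R_\omega=d\omega-\langle\omega,\omega\rangle$,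 and let $R_\omega^\otimes\colon\Gamma_{inv}^\otimes\to\Omega(P)$ be the unital multiplicative extension of $R_\omega$ to the tensor algebra of $\Gamma_{inv}$. Let $\mathcal K_\omega\subseteq\Omega(P)$ be the two-sided ideal generated by the elements $\langle\omega,\varphi\rangle(\vartheta)-(-1)^{\partial\varphi}\langle\varphi,\omega\rangle(\vartheta)$, for all pseudotensorial forms $\varphi$ and all $\vartheta\in\Gamma_{inv}$. Let $I^\star\subseteq\Gamma_{inv}^\otimes$ be the algebra of elements invariant under the adjoint action, with the involution $(\vartheta_1\otimes\cdots\otimes\vartheta_n)^*=\vartheta_n^*\otimes\cdots\otimes\vartheta_1^*$, and put $W^\omega(\vartheta)=R_\omega^\otimes(\vartheta)$ for $\vartheta\in I^\star$. Suppose that $\mathcal X$ is a (non-empty) real affine space of connections such that $\mathrm{hor}(P)\cap\mathcal K_\omega=\{0\}$ for every $\omega\in\mathcal X$. Then: (i) for each $\omega\in\mathcal X$ and $\vartheta\in I^\star$, the form $W^\omega(\vartheta)$ belongs to $\Omega(M)$ and is closed; (ii) the cohomology class of $W^\omega(\vartheta)$ in $\Omega(M)$ does not depend on $\omega\in\mathcal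 X$, the space $I^\star$ is closed under the involution, and the resulting map $W\colon I^\star\to H(M)$, $W(\vartheta)=[W^\omega(\vartheta)]$, is a unital *-homomorphism. -/

import Mathlib

open scoped TensorProduct
open MulOpposite

namespace QuantumBundle

set_option linter.unusedSectionVars false

noncomputable section

/-- A Hopf *-algebra: a complex Hopf algebra which is a *-algebra such that the coproduct is a
*-homomorphism, where `A ⊗ A` carries the *-structure `(a ⊗ b)* = a* ⊗ b*`. -/
class HopfStarAlgebra (A : Type*) [Ring A] [HopfAlgebra ℂ A] [StarRing A] [StarModule ℂ A] :
    Prop where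
  comul_star : ∀ a : A, (Coalgebra.comul (R := ℂ) (star a) : A ⊗[ℂ] A) =
    star (Coalgebra.comul (R := ℂ) a)

section Bimodule

variable (A Γ : Type*) [Ring A] [Algebra ℂ A] [AddCommGroup Γ] [Module ℂ Γ] [Module A Γ]
  [IsScalarTower ℂ A Γ]

/-- The left module structure as a bilinear map. -/
def lAct : A →ₗ[ℂ] Γ →ₗ[ℂ] Γ := (Algebra.lsmul ℂ ℂ Γ : A →ₐ[ℂ] Module.End ℂ Γ).toLinearMap

/-- `(a ⊗ b) · (c ⊗ ξ) = a c ⊗ b ξ`. -/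
def actR : A ⊗[ℂ] A →ₗ[ℂ] A ⊗[ℂ] Γ →ₗ[ℂ] A ⊗[ℂ] Γ :=
  TensorProduct.map₂ (LinearMap.mul ℂ A) (lAct A Γ)

/-- `(a ⊗ b) · (ξ ⊗ c) = a ξ ⊗ b c`. -/
def actL : A ⊗[ℂ] A →ₗ[ℂ] Γ ⊗[ℂ] A →ₗ[ℂ] Γ ⊗[ℂ] A :=
  TensorProduct.map₂ (lAct A Γ) (LinearMap.mul ℂ A)

variable {A Γ}

@[simp] lemma lAct_apply (a : A) (ξ : Γ) : lAct A Γ a ξ = a • ξ := rfl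

@[simp] lemma actR_tmul (a b c : A) (ξ : Γ) :
    actR A Γ (a ⊗ₜ b) (c ⊗ₜ ξ) = (a * c) ⊗ₜ (b • ξ) := rfl

@[simp] lemma actL_tmul (a b c : A) (ξ : Γ) :
    actL A Γ (a ⊗ₜ b) (ξ ⊗ₜ c) = (a • ξ) ⊗ₜ (b * c) := rfl

end Bimodule

/-- A bicovariant first-order *-calculus over the quantum group represented by `A`: an `A`-bimodule
`Γ` with a derivation `d : A → Γ` such that `Γ` is spanned by the elements `a d(b)`, such that the
left and right actions of the quantum group on `Γ`,
`a d(b) ↦ φ(a) (id ⊗ d)(φ(b))` and `a d(b) ↦ φ(a) (d ⊗ id)(φ(b))`, are well defined, and such that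
the antilinear involution of `Γ` satisfies `(a d(b))* = d(b*) a*`. -/
structure BicovariantCalculus (A Γ : Type*) [Ring A] [HopfAlgebra ℂ A] [StarRing A]
    [StarModule ℂ A] [AddCommGroup Γ] [Module ℂ Γ] [Module A Γ] [Module Aᵐᵒᵖ Γ]
    [IsScalarTower ℂ A Γ] [IsScalarTower ℂ Aᵐᵒᵖ Γ] [SMulCommClass A Aᵐᵒᵖ Γ]
    [StarAddMonoid Γ] [StarModule ℂ Γ] where
  d : A →ₗ[ℂ] Γ
  leibniz : ∀ a b : A, d (a * b) = a • d b + op b • d a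
  spanned : ∀ ξ : Γ, ξ ∈ Submodule.span ℂ {η : Γ | ∃ a b : A, η = a • d b}
  leftAction : Γ →ₗ[ℂ] A ⊗[ℂ] Γ
  leftAction_smul_d : ∀ a b : A, leftAction (a • d b) =
    actR A Γ (Coalgebra.comul a) (d.lTensor A (Coalgebra.comul b))
  rightAction : Γ →ₗ[ℂ] Γ ⊗[ℂ] A
  rightAction_smul_d : ∀ a b : A, rightAction (a • d b) =
    actL A Γ (Coalgebra.comul a) (d.rTensor A (Coalgebra.comul b))
  star_smul_d : ∀ a b : A, star (a • d b) = op (star a) • d (star b)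

namespace BicovariantCalculus

variable {A Γ : Type*} [Ring A] [HopfAlgebra ℂ A] [StarRing A] [StarModule ℂ A]
  [AddCommGroup Γ] [Module ℂ Γ] [Module A Γ] [Module Aᵐᵒᵖ Γ]
  [IsScalarTower ℂ A Γ] [IsScalarTower ℂ Aᵐᵒᵖ Γ] [SMulCommClass A Aᵐᵒᵖ Γ]
  [StarAddMonoid Γ] [StarModule ℂ Γ] (C : BicovariantCalculus A Γ)

/-- The linear map `a ⊗ b ↦ a d(b)`. -/
def adb : A ⊗[ℂ] A →ₗ[ℂ] Γ := TensorProduct.lift ((lAct A Γ).compl₂ C.d)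

@[simp] lemma adb_tmul (a b : A) : C.adb (a ⊗ₜ b) = a • C.d b := rfl

lemma adb_surjective : Function.Surjective C.adb := by
  rw [← LinearMap.range_eq_top, eq_top_iff]
  intro ξ _
  refine (Submodule.span_le.2 ?_) (C.spanned ξ)
  rintro _ ⟨a, b, rfl⟩
  exact ⟨a ⊗ₜ b, rfl⟩

theorem induction {p : Γ → Prop} (h : ∀ a b : A, p (a • C.d b))
    (hadd : ∀ x y, p x → p y → p (x + y)) (ξ : Γ) : p ξ := by
  obtain ⟨t, rfl⟩ := C.adb_surjective ξ
  induction t with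
  | zero => simpa using h 0 0
  | tmul a b => exact h a b
  | add x y hx hy => rw [map_add]; exact hadd _ _ hx hy

lemma d_one : C.d 1 = 0 := by
  have h := C.leibniz 1 1
  simpa using h

lemma star_d (a : A) : star (C.d a) = C.d (star a) := by
  have h := C.star_smul_d 1 a
  simpa using h

lemma star_smul (C : BicovariantCalculus A Γ) (a : A) (ξ : Γ) : star (a • ξ) = op (star a) • star ξ := by
  induction ξ using C.induction with
  | h b c => rw [← mul_smul, C.star_smul_d, C.star_smul_d, star_mul, op_mul, mul_smul]
  | hadd x y hx hy => simp only [smul_add, star_add, hx, hy]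

lemma star_op_smul (C : BicovariantCalculus A Γ) (a : A) (ξ : Γ) : star (op a • ξ) = star a • star ξ := by
  have h := C.star_smul (star a) (star ξ)
  rw [star_star, star_star] at h
  rw [← h, star_star]

/-- The left-invariant part of the calculus. -/
def inv : Submodule ℂ Γ where
  carrier := {ξ | C.leftAction ξ = 1 ⊗ₜ ξ}
  add_mem' {x y} hx hy := by
    simp only [Set.mem_ofPred_eq] at hx hy ⊢
    rw [map_add, hx, hy, TensorProduct.tmul_add]
  zero_mem' := by simp
  smul_mem' z x hx := by
    simp only [Set.mem_ofPred_eq] at hx ⊢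
    rw [map_smul, hx, TensorProduct.tmul_smul]

lemma mem_inv {ξ : Γ} : ξ ∈ C.inv ↔ C.leftAction ξ = 1 ⊗ₜ ξ := Iff.rfl

section Star

variable [HopfStarAlgebra A]

lemma star_actR_aux (X Y : A ⊗[ℂ] A) :
    star (actR A Γ X (C.d.lTensor A Y)) =
      C.d.lTensor A (star Y * star X) - actR A Γ (star Y) (C.d.lTensor A (star X)) := by
  induction X with
  | zero => simp
  | add X X' h h' =>
    simp only [map_add, LinearMap.add_apply, star_add, h, h', mul_add]; abel
  | tmul x x' =>
    induction Y with
    | zero => simp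
    | add Y Y' h h' =>
      simp only [map_add, LinearMap.add_apply, star_add, h, h', add_mul]; abel
    | tmul y y' =>
      simp only [LinearMap.lTensor_tmul, actR_tmul, TensorProduct.star_tmul,
        Algebra.TensorProduct.tmul_mul_tmul, ← TensorProduct.tmul_sub, C.leibniz, C.star_smul_d,
        star_mul, add_sub_cancel_left]

lemma leftAction_star (ξ : Γ) : C.leftAction (star ξ) = star (C.leftAction ξ) := by
  induction ξ using C.induction with
  | hadd x y hx hy => simp only [star_add, map_add, hx, hy]
  | h a b =>
    have h1 : star (a • C.d b) = (1 : A) • C.d (star b * star a) - star b • C.d (star a) := by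
      rw [C.star_smul_d, C.leibniz, one_smul, add_sub_cancel_left]
    rw [h1, map_sub, C.leftAction_smul_d, C.leftAction_smul_d, C.leftAction_smul_d,
      C.star_actR_aux, Bialgebra.comul_mul, HopfStarAlgebra.comul_star,
      HopfStarAlgebra.comul_star, Bialgebra.comul_one]
    congr 1
    generalize C.d.lTensor A _ = Z
    induction Z with
    | zero => simp
    | add Z Z' h h' => simp only [map_add, h, h']
    | tmul z ζ => rw [Algebra.TensorProduct.one_def, actR_tmul, one_mul, one_smul]

/-- The antilinear involution of the left-invariant part. -/
instance : StarAddMonoid C.inv where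
  star x := ⟨star x.1, by
    have h := x.2
    rw [mem_inv] at h ⊢
    rw [C.leftAction_star, h, TensorProduct.star_tmul, star_one]⟩
  star_involutive x := Subtype.ext (star_star x.1)
  star_add x y := Subtype.ext (star_add x.1 y.1)

@[simp] lemma coe_star_inv (x : C.inv) : ((star x : C.inv) : Γ) = star (x : Γ) := rfl

instance : StarModule ℂ C.inv where
  star_smul z x := Subtype.ext (StarModule.star_smul z x.1)

end Star

lemma coaction_auxL (X Y : A ⊗[ℂ] A) :
    C.leftAction.rTensor A (actL A Γ X (C.d.rTensor A Y)) =
      (TensorProduct.assoc ℂ A Γ A).symm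
        (TensorProduct.map₂ (LinearMap.mul ℂ A) (actL A Γ)
          (TensorProduct.assoc ℂ A A A ((Coalgebra.comul (R := ℂ) (A := A)).rTensor A X))
          ((C.d.rTensor A).lTensor A
            (TensorProduct.assoc ℂ A A A ((Coalgebra.comul (R := ℂ) (A := A)).rTensor A Y)))) := by
  induction X with
  | zero => simp
  | add X X' h h' => simp only [map_add, LinearMap.add_apply, h, h']
  | tmul x x' =>
    induction Y with
    | zero => simp
    | add Y Y' h h' => simp only [map_add, h, h']
    | tmul y y' =>
      simp only [LinearMap.rTensor_tmul, actL_tmul, C.leftAction_smul_d]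
      generalize (Coalgebra.comul (R := ℂ) x : A ⊗[ℂ] A) = X
      generalize (Coalgebra.comul (R := ℂ) y : A ⊗[ℂ] A) = Y
      induction X with
      | zero => simp
      | add X X' h h' =>
        simp only [map_add, LinearMap.add_apply, TensorProduct.add_tmul, h, h']
      | tmul u u' =>
        induction Y with
        | zero => simp
        | add Y Y' h h' => simp only [map_add, TensorProduct.add_tmul, h, h']
        | tmul v v' => simp

lemma coaction_auxR (X Y : A ⊗[ℂ] A) :
    C.rightAction.lTensor A (actR A Γ X (C.d.lTensor A Y)) =
        (TensorProduct.map₂ (LinearMap.mul ℂ A) (actL A Γ)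
          ((Coalgebra.comul (R := ℂ) (A := A)).lTensor A X)
          ((C.d.rTensor A).lTensor A
            ((Coalgebra.comul (R := ℂ) (A := A)).lTensor A Y))) := by
  induction X with
  | zero => simp
  | add X X' h h' => simp only [map_add, LinearMap.add_apply, h, h']
  | tmul x x' =>
    induction Y with
    | zero => simp
    | add Y Y' h h' => simp only [map_add, h, h']
    | tmul y y' => simp [C.rightAction_smul_d]

lemma leftAction_rightAction (ξ : Γ) :
    C.leftAction.rTensor A (C.rightAction ξ) =
      (TensorProduct.assoc ℂ A Γ A).symm (C.rightAction.lTensor A (C.leftAction ξ)) := by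
  induction ξ using C.induction with
  | hadd x y hx hy => simp only [map_add, hx, hy]
  | h a b =>
    rw [C.rightAction_smul_d, C.leftAction_smul_d, C.coaction_auxL, C.coaction_auxR,
      Coalgebra.coassoc_apply, Coalgebra.coassoc_apply]

lemma rightAction_mem (ϑ : C.inv) :
    C.rightAction ϑ ∈ LinearMap.range (C.inv.subtype.rTensor A) := by
  have hex : Function.Exact C.inv.subtype
      (C.leftAction - TensorProduct.mk ℂ A Γ 1 : Γ →ₗ[ℂ] A ⊗[ℂ] Γ) := by
    intro ξ
    simp [sub_eq_zero, mem_inv]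
  rw [LinearMap.mem_range]
  refine (Module.Flat.rTensor_exact A hex _).1 ?_
  rw [LinearMap.rTensor_sub]
  change C.leftAction.rTensor A _ - (TensorProduct.mk ℂ A Γ 1).rTensor A _ = 0
  rw [C.leftAction_rightAction, C.mem_inv.1 ϑ.2,
    sub_eq_zero, LinearMap.lTensor_tmul]
  generalize C.rightAction _ = Z
  induction Z with
  | zero => simp
  | add Z Z' h h' => simp only [TensorProduct.tmul_add, map_add, h, h']
  | tmul z a => simp

lemma inv_rTensor_injective : Function.Injective (C.inv.subtype.rTensor A) :=
  Module.Flat.rTensor_preserves_injective_linearMap _ C.inv.injective_subtype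

/-- The adjoint action `ϖ : Γ_inv → Γ_inv ⊗ A`, i.e. the restriction of the right action. -/
def varpi : C.inv →ₗ[ℂ] C.inv ⊗[ℂ] A :=
  (LinearEquiv.ofInjective _ C.inv_rTensor_injective).symm.toLinearMap ∘ₗ
    (C.rightAction ∘ₗ C.inv.subtype).codRestrict _ C.rightAction_mem

lemma rTensor_varpi (ϑ : C.inv) : C.inv.subtype.rTensor A (C.varpi ϑ) = C.rightAction ϑ := by
  have := LinearEquiv.apply_symm_apply (LinearEquiv.ofInjective _ C.inv_rTensor_injective)
    ((C.rightAction ∘ₗ C.inv.subtype).codRestrict _ C.rightAction_mem ϑ)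
  exact congrArg Subtype.val this

end BicovariantCalculus

section GradedDifferential

/-- A graded-differential *-algebra structure on a complex algebra `Ω` with an antilinear
involution: a grading by `ℕ`, a differential of degree one, with the graded Leibniz rule, and the
graded rule `(x y)* = (-1)^{|x||y|} y* x*` for the involution, which commutes with `d`. -/
structure GDStarAlgebra (Ω : Type*) [Ring Ω] [Algebra ℂ Ω] [StarAddMonoid Ω] [StarModule ℂ Ω] where
  deg : ℕ → Submodule ℂ Ω
  graded : GradedAlgebra deg
  d : Ω →ₗ[ℂ] Ω
  d_mem : ∀ n, ∀ x ∈ deg n, d x ∈ deg (n + 1)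
  d_d : ∀ x, d (d x) = 0
  leibniz : ∀ p, ∀ x ∈ deg p, ∀ y, d (x * y) = d x * y + (-1 : ℂ) ^ p • (x * d y)
  star_mem : ∀ n, ∀ x ∈ deg n, star x ∈ deg n
  star_mul : ∀ p q, ∀ x ∈ deg p, ∀ y ∈ deg q,
    star (x * y) = (-1 : ℂ) ^ (p * q) • (star y * star x)
  star_d : ∀ x, star (d x) = d (star x)

attribute [instance] GDStarAlgebra.graded

/-- The linear map multiplying the component of degree `n` by `s n`. -/
def gradeScale {Ω : Type*} [Ring Ω] [Algebra ℂ Ω] (𝒜 : ℕ → Submodule ℂ Ω) [GradedAlgebra 𝒜]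
    (s : ℕ → ℂ) : Ω →ₗ[ℂ] Ω :=
  (DirectSum.decomposeLinearEquiv 𝒜).symm.toLinearMap ∘ₗ
    DirectSum.lmap (fun n => s n • (LinearMap.id : 𝒜 n →ₗ[ℂ] 𝒜 n)) ∘ₗ
      (DirectSum.decomposeLinearEquiv 𝒜).toLinearMap

lemma gradeScale_of_mem {Ω : Type*} [Ring Ω] [Algebra ℂ Ω] (𝒜 : ℕ → Submodule ℂ Ω)
    [GradedAlgebra 𝒜] (s : ℕ → ℂ) {n : ℕ} {x : Ω} (hx : x ∈ 𝒜 n) :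
    gradeScale 𝒜 s x = s n • x := by
  lift x to 𝒜 n using hx
  simp [gradeScale]

theorem graded_induction {Ω : Type*} [Ring Ω] [Algebra ℂ Ω] (𝒜 : ℕ → Submodule ℂ Ω)
    [GradedAlgebra 𝒜] {p : Ω → Prop} (h : ∀ n, ∀ x ∈ 𝒜 n, p x)
    (hadd : ∀ x y, p x → p y → p (x + y)) (x : Ω) : p x :=
  DirectSum.Decomposition.inductionOn 𝒜 (h 0 0 (zero_mem _)) (fun {i} m => h i m m.2)
    (fun x y => hadd x y) x

namespace GDStarAlgebra

variable {Ω Λ : Type*} [Ring Ω] [Algebra ℂ Ω] [StarAddMonoid Ω] [StarModule ℂ Ω]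
  [Ring Λ] [Algebra ℂ Λ] [StarAddMonoid Λ] [StarModule ℂ Λ]

/-- The grading involution `x ↦ (-1)^{|x|} x`. -/
def sgn (S : GDStarAlgebra Ω) : Ω →ₗ[ℂ] Ω := gradeScale S.deg (fun n => (-1) ^ n)

lemma sgn_of_mem (S : GDStarAlgebra Ω) {n : ℕ} {x : Ω} (hx : x ∈ S.deg n) :
    S.sgn x = (-1 : ℂ) ^ n • x := gradeScale_of_mem _ _ hx

/-- The component of total degree `n` of a tensor product. -/
def tensorDeg (S : GDStarAlgebra Ω) (T : GDStarAlgebra Λ) (n : ℕ) : Submodule ℂ (Ω ⊗[ℂ] Λ) :=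
  ⨆ (p : ℕ) (q : ℕ) (_ : p + q = n),
    LinearMap.range (TensorProduct.map (S.deg p).subtype (T.deg q).subtype)

/-- The differential `x ⊗ y ↦ d x ⊗ y + (-1)^{|x|} x ⊗ d y` of a tensor product. -/
def tensorD (S : GDStarAlgebra Ω) (T : GDStarAlgebra Λ) : Ω ⊗[ℂ] Λ →ₗ[ℂ] Ω ⊗[ℂ] Λ :=
  TensorProduct.map S.d LinearMap.id + TensorProduct.map S.sgn T.d

lemma d_mul (S : GDStarAlgebra Ω) (x y : Ω) : S.d (x * y) = S.d x * y + S.sgn x * S.d y := by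
  induction x using graded_induction S.deg with
  | h n x hx => rw [S.leibniz n x hx, S.sgn_of_mem hx, smul_mul_assoc]
  | hadd x x' h h' => simp only [add_mul, map_add, h, h']; abel

lemma d_one (S : GDStarAlgebra Ω) : S.d 1 = 0 := by
  have h := S.leibniz 0 1 SetLike.GradedOne.one_mem 1
  simpa using h

lemma sgn_sgn (S : GDStarAlgebra Ω) (x : Ω) : S.sgn (S.sgn x) = x := by
  induction x using graded_induction S.deg with
  | h n x hx =>
    rw [S.sgn_of_mem hx, map_smul, S.sgn_of_mem hx, smul_smul, ← mul_pow]
    simp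
  | hadd x x' h h' => simp only [map_add, h, h']

lemma d_sgn (S : GDStarAlgebra Ω) (x : Ω) : S.d (S.sgn x) = -S.sgn (S.d x) := by
  induction x using graded_induction S.deg with
  | h n x hx =>
    rw [S.sgn_of_mem hx, map_smul, S.sgn_of_mem (S.d_mem _ _ hx), pow_succ]
    simp
  | hadd x x' h h' => simp only [map_add, h, h', neg_add]

end GDStarAlgebra

/-- The opposite of a complex algebra, with the complex conjugate scalar multiplication. Algebra
homomorphisms `R → ConjOp S` are the antilinear antihomomorphisms `R → S`. -/
def ConjOp (R : Type*) : Type _ := Rᵐᵒᵖ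

instance (R : Type*) [Ring R] : Ring (ConjOp R) := inferInstanceAs (Ring Rᵐᵒᵖ)

/-- The identity, as a map to the conjugate opposite algebra. -/
def toConjOp {R : Type*} [Ring R] : R ≃+ ConjOp R := opAddEquiv

lemma toConjOp_mul {R : Type*} [Ring R] (x y : R) :
    toConjOp (x * y) = toConjOp y * toConjOp x := rfl

lemma toConjOp_symm_mul {R : Type*} [Ring R] (x y : ConjOp R) :
    toConjOp.symm (x * y) = toConjOp.symm y * toConjOp.symm x := rfl

lemma toConjOp_one {R : Type*} [Ring R] : toConjOp (1 : R) = 1 := rfl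

lemma toConjOp_symm_one {R : Type*} [Ring R] : toConjOp.symm (1 : ConjOp R) = 1 := rfl

instance (R : Type*) [Ring R] [Algebra ℂ R] : Algebra ℂ (ConjOp R) where
  smul z x := toConjOp (star z • toConjOp.symm x)
  algebraMap :=
    { toFun := fun z => toConjOp (algebraMap ℂ R (star z))
      map_one' := by simp [toConjOp_one]
      map_mul' := fun z w => by
        rw [star_mul, map_mul, toConjOp_mul]
      map_zero' := by simp
      map_add' := fun z w => by simp }
  commutes' z x := by
    obtain ⟨x, rfl⟩ := toConjOp.surjective x
    change toConjOp _ * toConjOp _ = toConjOp _ * toConjOp _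
    rw [← toConjOp_mul, ← toConjOp_mul, Algebra.commutes]
  smul_def' z x := by
    obtain ⟨x, rfl⟩ := toConjOp.surjective x
    change toConjOp (star z • x) = toConjOp _ * toConjOp _
    rw [← toConjOp_mul, Algebra.smul_def, Algebra.commutes]

lemma toConjOp_smul {R : Type*} [Ring R] [Algebra ℂ R] (z : ℂ) (x : R) :
    toConjOp (z • x) = star z • toConjOp x := by
  change _ = toConjOp (star (star z) • x)
  rw [star_star]

lemma toConjOp_symm_smul {R : Type*} [Ring R] [Algebra ℂ R] (z : ℂ) (x : ConjOp R) :
    toConjOp.symm (z • x) = star z • toConjOp.symm x := rfl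

end GradedDifferential

namespace BicovariantCalculus

variable {A Γ : Type*} [Ring A] [HopfAlgebra ℂ A] [StarRing A] [StarModule ℂ A]
  [AddCommGroup Γ] [Module ℂ Γ] [Module A Γ] [Module Aᵐᵒᵖ Γ]
  [IsScalarTower ℂ A Γ] [IsScalarTower ℂ Aᵐᵒᵖ Γ] [SMulCommClass A Aᵐᵒᵖ Γ]
  [StarAddMonoid Γ] [StarModule ℂ Γ] (C : BicovariantCalculus A Γ)

/-- The generators `a ∈ A` of the envelope. -/
def preA : A →ₗ[ℂ] TensorAlgebra ℂ (A × Γ) := TensorAlgebra.ι ℂ ∘ₗ LinearMap.inl ℂ A Γ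

/-- The generators `ξ ∈ Γ` of the envelope. -/
def preΓ : Γ →ₗ[ℂ] TensorAlgebra ℂ (A × Γ) := TensorAlgebra.ι ℂ ∘ₗ LinearMap.inr ℂ A Γ

/-- The defining relations of the universal differential envelope. The first four make the
quotient of the free algebra on `A ⊕ Γ` the tensor bundle algebra of `Γ` over `A`; the last one
imposes `∑ d(aₖ) d(bₖ) = 0` whenever `∑ aₖ d(bₖ) = 0`. -/
inductive EnvelopeRel : TensorAlgebra ℂ (A × Γ) → TensorAlgebra ℂ (A × Γ) → Prop
  | one : EnvelopeRel (preA 1) 1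
  | mul (a b : A) : EnvelopeRel (preA a * preA b) (preA (a * b))
  | smul (a : A) (ξ : Γ) : EnvelopeRel (preA a * preΓ ξ) (preΓ (a • ξ))
  | op_smul (ξ : Γ) (a : A) : EnvelopeRel (preΓ ξ * preA a) (preΓ (op a • ξ))
  | dd (t : A ⊗[ℂ] A) (ht : C.adb t = 0) :
      EnvelopeRel (TensorProduct.lift
        ((LinearMap.mul ℂ (TensorAlgebra ℂ (A × Γ))).compl₁₂ (preΓ ∘ₗ C.d) (preΓ ∘ₗ C.d)) t) 0

/-- The universal differential envelope `Γ^∧` of the calculus: the quotient of the tensor bundle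
algebra of `Γ` by the ideal generated by the elements `∑ d(aₖ) d(bₖ)` with `∑ aₖ d(bₖ) = 0`. -/
def Envelope : Type _ := RingQuot C.EnvelopeRel

namespace Envelope

instance : Ring C.Envelope := inferInstanceAs (Ring (RingQuot C.EnvelopeRel))

instance : Algebra ℂ C.Envelope := inferInstanceAs (Algebra ℂ (RingQuot C.EnvelopeRel))

/-- The quotient map. -/
def mk : TensorAlgebra ℂ (A × Γ) →ₐ[ℂ] C.Envelope := RingQuot.mkAlgHom ℂ C.EnvelopeRel

lemma mk_surjective : Function.Surjective (mk C) := RingQuot.mkAlgHom_surjective _ _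

/-- The degree zero part: `A → Γ^∧`. -/
def ofA : A →ₐ[ℂ] C.Envelope :=
  AlgHom.ofLinearMap ((mk C).toLinearMap ∘ₗ preA)
    (by
      have h : mk C (preA 1) = mk C 1 := RingQuot.mkAlgHom_rel ℂ (EnvelopeRel.one)
      simpa using h)
    (fun a b => by
      have h : mk C (preA a * preA b) = mk C (preA (a * b)) :=
        RingQuot.mkAlgHom_rel ℂ (EnvelopeRel.mul a b)
      simpa using h.symm)

/-- The degree one part: `Γ → Γ^∧`. -/
def ofΓ : Γ →ₗ[ℂ] C.Envelope := (mk C).toLinearMap ∘ₗ preΓ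

lemma mk_preA (a : A) : mk C (preA a) = ofA C a := rfl

lemma mk_preΓ (ξ : Γ) : mk C (preΓ ξ) = ofΓ C ξ := rfl

lemma ofΓ_smul (a : A) (ξ : Γ) : ofΓ C (a • ξ) = ofA C a * ofΓ C ξ := by
  have h : mk C (preA a * preΓ ξ) = mk C (preΓ (a • ξ)) :=
    RingQuot.mkAlgHom_rel ℂ (EnvelopeRel.smul a ξ)
  rw [map_mul] at h
  exact h.symm

lemma ofΓ_op_smul (ξ : Γ) (a : A) : ofΓ C (op a • ξ) = ofΓ C ξ * ofA C a := by
  have h : mk C (preΓ ξ * preA a) = mk C (preΓ (op a • ξ)) :=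
    RingQuot.mkAlgHom_rel ℂ (EnvelopeRel.op_smul ξ a)
  rw [map_mul] at h
  exact h.symm

/-- The linear map `a ⊗ b ↦ d(a) d(b)`. -/
def ddMap : A ⊗[ℂ] A →ₗ[ℂ] C.Envelope :=
  TensorProduct.lift
    ((LinearMap.mul ℂ C.Envelope).compl₁₂ (ofΓ C ∘ₗ C.d) (ofΓ C ∘ₗ C.d))

@[simp] lemma ddMap_tmul (a b : A) :
    ddMap C (a ⊗ₜ b) = ofΓ C (C.d a) * ofΓ C (C.d b) := rfl

lemma ddMap_eq_zero (t : A ⊗[ℂ] A) (ht : C.adb t = 0) : ddMap C t = 0 := by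
  have h := RingQuot.mkAlgHom_rel ℂ (EnvelopeRel.dd (C := C) t ht)
  change mk C _ = mk C _ at h
  rw [map_zero] at h
  rw [← h]
  clear h ht
  induction t with
  | zero => simp
  | add x y hx hy => rw [map_add, hx, hy, map_add, map_add]
  | tmul a b => simp [mk_preΓ]

/-- The universal property of the envelope as an algebra. -/
def lift {R : Type*} [Ring R] [Algebra ℂ R] (f : A →ₐ[ℂ] R) (g : Γ →ₗ[ℂ] R)
    (h₁ : ∀ a ξ, g (a • ξ) = f a * g ξ) (h₂ : ∀ ξ a, g (op a • ξ) = g ξ * f a)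
    (h₃ : ∀ t, C.adb t = 0 →
      TensorProduct.lift ((LinearMap.mul ℂ R).compl₁₂ (g ∘ₗ C.d) (g ∘ₗ C.d)) t = 0) :
    C.Envelope →ₐ[ℂ] R :=
  RingQuot.liftAlgHom ℂ ⟨TensorAlgebra.lift ℂ (f.toLinearMap.coprod g), by
    intro x y hxy
    induction hxy with
    | one => simp [preA]
    | mul a b => simp [preA]
    | smul a ξ => simp [preA, preΓ, h₁]
    | op_smul ξ a => simp [preA, preΓ, h₂]
    | dd t ht =>
      rw [map_zero, ← h₃ t ht]
      clear ht
      induction t with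
      | zero => simp
      | add x y hx hy => rw [map_add, map_add, hx, hy, map_add]
      | tmul a b => simp [preΓ]⟩

section lift

variable {R : Type*} [Ring R] [Algebra ℂ R] (f : A →ₐ[ℂ] R) (g : Γ →ₗ[ℂ] R)
    (h₁ : ∀ a ξ, g (a • ξ) = f a * g ξ) (h₂ : ∀ ξ a, g (op a • ξ) = g ξ * f a)
    (h₃ : ∀ t, C.adb t = 0 →
      TensorProduct.lift ((LinearMap.mul ℂ R).compl₁₂ (g ∘ₗ C.d) (g ∘ₗ C.d)) t = 0)

@[simp] lemma lift_ofA (a : A) : lift C f g h₁ h₂ h₃ (ofA C a) = f a := by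
  refine (RingQuot.liftAlgHom_mkAlgHom_apply ℂ _ _ _).trans ?_
  simp [preA]

@[simp] lemma lift_ofΓ (ξ : Γ) : lift C f g h₁ h₂ h₃ (ofΓ C ξ) = g ξ := by
  refine (RingQuot.liftAlgHom_mkAlgHom_apply ℂ _ _ _).trans ?_
  simp [preΓ]

end lift

/-- The envelope is generated by `A` and `Γ`. -/
theorem induction {p : C.Envelope → Prop} (hA : ∀ a, p (ofA C a)) (hΓ : ∀ ξ, p (ofΓ C ξ))
    (hadd : ∀ x y, p x → p y → p (x + y)) (hmul : ∀ x y, p x → p y → p (x * y))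
    (x : C.Envelope) : p x := by
  obtain ⟨t, rfl⟩ := mk_surjective C x
  induction t using TensorAlgebra.induction with
  | algebraMap r =>
    have h := hA (algebraMap ℂ A r)
    rwa [AlgHom.commutes] at h ⊢
  | ι m =>
    have h : TensorAlgebra.ι ℂ m = (preA m.1 + preΓ m.2 : TensorAlgebra ℂ (A × Γ)) := by
      simp [preA, preΓ, ← map_add]
    rw [h, map_add]
    exact hadd _ _ (hA _) (hΓ _)
  | mul x y hx hy => rw [map_mul]; exact hmul _ _ hx hy
  | add x y hx hy => rw [map_add]; exact hadd _ _ hx hy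

theorem hom_ext {R : Type*} [Ring R] [Algebra ℂ R] {f g : C.Envelope →ₐ[ℂ] R}
    (hA : ∀ a, f (ofA C a) = g (ofA C a)) (hΓ : ∀ ξ, f (ofΓ C ξ) = g (ofΓ C ξ)) : f = g := by
  ext x
  induction x using induction C with
  | hA a => exact hA a
  | hΓ ξ => exact hΓ ξ
  | hadd x y hx hy => rw [map_add, map_add, hx, hy]
  | hmul x y hx hy => rw [map_mul, map_mul, hx, hy]

/-- The projection `p_* : Γ^∧ → A` onto the degree zero part. -/
def proj : C.Envelope →ₐ[ℂ] A :=
  lift C (AlgHom.id ℂ A) 0 (by simp) (by simp) (fun t ht => by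
    clear ht
    induction t with
    | zero => simp
    | add x y hx hy => rw [map_add, hx, hy, add_zero]
    | tmul a b => simp)

open Polynomial in
/-- The algebra homomorphism `x ↦ x X^n` for `x` of degree `n`, which encodes the grading. -/
def wt : C.Envelope →ₐ[ℂ] C.Envelope[X] :=
  lift C (CAlgHom.comp (ofA C)) ((monomial 1).restrictScalars ℂ ∘ₗ ofΓ C)
    (fun a ξ => by simp [ofΓ_smul, C_mul_monomial])
    (fun ξ a => by simp [ofΓ_op_smul, monomial_mul_C])
    (fun t ht => by
      have h : ∀ t, TensorProduct.lift ((LinearMap.mul ℂ C.Envelope[X]).compl₁₂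
          (((monomial 1).restrictScalars ℂ ∘ₗ ofΓ C) ∘ₗ C.d)
          (((monomial 1).restrictScalars ℂ ∘ₗ ofΓ C) ∘ₗ C.d)) t =
            monomial 2 (ddMap C t) := by
        intro t
        induction t with
        | zero => simp
        | add x y hx hy => simp only [map_add, hx, hy]
        | tmul a b => simp [monomial_mul_monomial]
      rw [h, ddMap_eq_zero C t ht, map_zero])

open Polynomial in
@[simp] lemma wt_ofA (a : A) : wt C (ofA C a) = Polynomial.C (ofA C a) := by simp [wt]

open Polynomial in
@[simp] lemma wt_ofΓ (ξ : Γ) : wt C (ofΓ C ξ) = monomial 1 (ofΓ C ξ) := by simp [wt]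

/-- The component of degree `n` of the envelope. -/
def deg (n : ℕ) : Submodule ℂ C.Envelope where
  carrier := {x | wt C x = Polynomial.monomial n x}
  add_mem' {x y} hx hy := by
    simp only [Set.mem_ofPred_eq] at hx hy ⊢
    rw [map_add, hx, hy, map_add]
  zero_mem' := by simp
  smul_mem' z x hx := by
    simp only [Set.mem_ofPred_eq] at hx ⊢
    rw [map_smul, hx, Polynomial.smul_monomial]

lemma mem_deg {n : ℕ} {x : C.Envelope} : x ∈ deg C n ↔ wt C x = Polynomial.monomial n x :=
  Iff.rfl

lemma ofA_mem (a : A) : ofA C a ∈ deg C 0 := by simp [mem_deg]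

lemma ofΓ_mem (ξ : Γ) : ofΓ C ξ ∈ deg C 1 := by simp [mem_deg]

instance : SetLike.GradedMonoid (deg C) where
  one_mem := by
    rw [← map_one (ofA C)]; exact ofA_mem C 1
  mul_mem i j x y hx hy := by
    rw [mem_deg] at hx hy ⊢
    rw [map_mul, hx, hy, Polynomial.monomial_mul_monomial]

/-- A property of homogeneous elements that holds for the components of the generators and is
stable under products and sums holds for all homogeneous components. -/
theorem coeff_induction {p : ℕ → C.Envelope → Prop} (h0 : ∀ n, p n 0)
    (hA : ∀ a, p 0 (ofA C a)) (hΓ : ∀ ξ, p 1 (ofΓ C ξ))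
    (hadd : ∀ n x y, p n x → p n y → p n (x + y))
    (hmul : ∀ m n x y, p m x → p n y → p (m + n) (x * y))
    (n : ℕ) (x : C.Envelope) : p n ((wt C x).coeff n) := by
  induction x using induction C generalizing n with
  | hA a =>
    rw [wt_ofA, Polynomial.coeff_C]
    split_ifs with h
    · subst h; exact hA a
    · exact h0 n
  | hΓ ξ =>
    rw [wt_ofΓ, Polynomial.coeff_monomial]
    split_ifs with h
    · subst h; exact hΓ ξ
    · exact h0 n
  | hadd x y hx hy => rw [map_add, Polynomial.coeff_add]; exact hadd _ _ _ (hx n) (hy n)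
  | hmul x y hx hy =>
    rw [map_mul, Polynomial.coeff_mul]
    refine Finset.sum_induction _ (p n) (fun a b => hadd n a b) (h0 n) ?_
    intro q hq
    rw [← Finset.HasAntidiagonal.mem_antidiagonal.1 hq]
    exact hmul _ _ _ _ (hx _) (hy _)

lemma coeff_of_mem {n : ℕ} {x : C.Envelope} (hx : x ∈ deg C n) : (wt C x).coeff n = x := by
  rw [(mem_deg C).1 hx, Polynomial.coeff_monomial_same]

theorem deg_induction {p : ∀ (n : ℕ) (x : C.Envelope), x ∈ deg C n → Prop}
    (h0 : ∀ n, p n 0 (zero_mem _))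
    (hA : ∀ a, p 0 (ofA C a) (ofA_mem C a)) (hΓ : ∀ ξ, p 1 (ofΓ C ξ) (ofΓ_mem C ξ))
    (hadd : ∀ n x y hx hy, p n x hx → p n y hy → p n (x + y) (add_mem hx hy))
    (hmul : ∀ m n x y hx hy, p m x hx → p n y hy →
      p (m + n) (x * y) (SetLike.mul_mem_graded hx hy))
    (n : ℕ) (x : C.Envelope) (hx : x ∈ deg C n) : p n x hx := by
  have h := coeff_induction C (p := fun n x => ∃ hx, p n x hx) (fun n => ⟨_, h0 n⟩)
    (fun a => ⟨_, hA a⟩) (fun ξ => ⟨_, hΓ ξ⟩)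
    (fun n x y hx hy => ⟨_, hadd n x y _ _ hx.2 hy.2⟩)
    (fun m n x y hx hy => ⟨_, hmul m n x y _ _ hx.2 hy.2⟩) n x
  rw [coeff_of_mem C hx] at h
  exact h.2

lemma coeff_mem (n : ℕ) (x : C.Envelope) : (wt C x).coeff n ∈ deg C n :=
  coeff_induction C (p := fun n x => x ∈ deg C n) (fun _ => zero_mem _) (ofA_mem C) (ofΓ_mem C)
    (fun _ _ _ => add_mem) (fun _ _ _ _ hx hy => SetLike.mul_mem_graded hx hy) n x

lemma eval_wt (x : C.Envelope) : (wt C x).eval 1 = x := by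
  induction x using induction C with
  | hA a => simp
  | hΓ ξ => simp
  | hadd x y hx hy => simp [hx, hy]
  | hmul x y hx hy =>
    rw [Polynomial.eval] at hx hy ⊢
    rw [map_mul, Polynomial.eval₂_mul_noncomm _ _ (fun k => Commute.one_right _), hx, hy]

lemma coe_directSum_apply (y : DirectSum ℕ (fun n => deg C n)) (n : ℕ) :
    (y n : C.Envelope) = (wt C (DirectSum.coeAddMonoidHom (deg C) y)).coeff n := by
  induction y using DirectSum.induction_on with
  | zero => simp
  | of i x =>
    rw [DirectSum.coeAddMonoidHom_of, (mem_deg C).1 x.2, Polynomial.coeff_monomial,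
      DirectSum.of_apply]
    split_ifs with h
    · subst h; rfl
    · rfl
  | add x y hx hy => simp [hx, hy]

lemma coe_sum_coeff (x : C.Envelope) : DirectSum.coeAddMonoidHom (deg C)
    (∑ n ∈ (wt C x).support, DirectSum.of (fun n => deg C n) n
      ⟨(wt C x).coeff n, coeff_mem C n x⟩) = x := by
  rw [map_sum]
  simp only [DirectSum.coeAddMonoidHom_of]
  conv_rhs => rw [← eval_wt C x, Polynomial.eval_eq_sum, Polynomial.sum]
  simp

instance graded : GradedAlgebra (deg C) where
  decompose' x := ∑ n ∈ (wt C x).support, DirectSum.of (fun n => deg C n) n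
    ⟨(wt C x).coeff n, coeff_mem C n x⟩
  left_inv x := coe_sum_coeff C x
  right_inv y := by
    ext n
    rw [coe_directSum_apply, coe_sum_coeff, ← coe_directSum_apply]

/-- The map `Γ → Γ^∧`, `a d(b) ↦ d(a) d(b)`. -/
def dΓ : Γ →ₗ[ℂ] C.Envelope :=
  (LinearMap.ker C.adb).liftQ (ddMap C) (fun t ht => ddMap_eq_zero C t ht) ∘ₗ
    (C.adb.quotKerEquivOfSurjective C.adb_surjective).symm.toLinearMap

lemma dΓ_adb (t : A ⊗[ℂ] A) : dΓ C (C.adb t) = ddMap C t := by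
  have h : (C.adb.quotKerEquivOfSurjective C.adb_surjective).symm (C.adb t) =
      (LinearMap.ker C.adb).mkQ t := by
    rw [LinearEquiv.symm_apply_eq]; rfl
  simp only [dΓ, LinearMap.comp_apply, LinearEquiv.coe_coe, h]
  exact Submodule.liftQ_apply _ _ _

lemma dΓ_smul_d (a b : A) : dΓ C (a • C.d b) = ofΓ C (C.d a) * ofΓ C (C.d b) := by
  rw [← adb_tmul, dΓ_adb, ddMap_tmul]

lemma dΓ_d (a : A) : dΓ C (C.d a) = 0 := by
  have h := dΓ_smul_d C 1 a
  rwa [one_smul, d_one, map_zero, zero_mul] at h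

lemma dΓ_smul (a : A) (ξ : Γ) :
    dΓ C (a • ξ) = ofA C a * dΓ C ξ + ofΓ C (C.d a) * ofΓ C ξ := by
  induction ξ using C.induction with
  | hadd x y hx hy => simp only [smul_add, map_add, mul_add, hx, hy]; abel
  | h b c =>
    rw [← mul_smul, dΓ_smul_d, dΓ_smul_d, C.leibniz, map_add, ofΓ_smul, ofΓ_op_smul, ofΓ_smul]
    noncomm_ring

lemma dΓ_op_smul (ξ : Γ) (a : A) :
    dΓ C (op a • ξ) = dΓ C ξ * ofA C a - ofΓ C ξ * ofΓ C (C.d a) := by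
  induction ξ using C.induction with
  | hadd x y hx hy => simp only [smul_add, map_add, add_mul, hx, hy]; abel
  | h b c =>
    have h : op a • (b • C.d c) = b • C.d (c * a) - (b * c) • C.d a := by
      rw [C.leibniz, smul_add, mul_smul, add_sub_cancel_left, ← smul_comm]
    rw [h, map_sub, dΓ_smul_d, dΓ_smul_d, dΓ_smul_d, C.leibniz, C.leibniz, map_add, map_add,
      ofΓ_smul, ofΓ_smul, ofΓ_op_smul, ofΓ_op_smul]
    noncomm_ring

/-- The algebra homomorphism `x ↦ ((-1)^{|x|} x, d x; 0, x)`, which encodes the differential. -/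
def diffHom : C.Envelope →ₐ[ℂ] Matrix (Fin 2) (Fin 2) C.Envelope :=
  lift C
    (AlgHom.ofLinearMap
      { toFun := fun a => !![ofA C a, ofΓ C (C.d a); 0, ofA C a]
        map_add' := fun a b => by simp
        map_smul' := fun z a => by simp }
      (by simp [d_one, Matrix.one_fin_two])
      (fun a b => by
        simp [C.leibniz, ofΓ_smul, ofΓ_op_smul]))
    { toFun := fun ξ => !![-ofΓ C ξ, dΓ C ξ; 0, ofΓ C ξ]
      map_add' := fun a b => by simp [add_comm]
      map_smul' := fun z a => by simp }
    (fun a ξ => by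
      simp [dΓ_smul, ofΓ_smul])
    (fun ξ a => by
      simp [dΓ_op_smul, ofΓ_op_smul]
      abel)
    (fun t ht => by
      refine Eq.trans (b := !![ddMap C t, 0; 0, ddMap C t]) ?_ ?_
      · clear ht
        induction t with
        | zero => ext i j; fin_cases i <;> fin_cases j <;> simp
        | add x y hx hy =>
          rw [map_add, hx, hy, map_add]
          ext i j; fin_cases i <;> fin_cases j <;> simp
        | tmul a b => simp [dΓ_d]
      · rw [ddMap_eq_zero C t ht]
        ext i j; fin_cases i <;> fin_cases j <;> simp)

lemma diffHom_ofA (a : A) : diffHom C (ofA C a) = !![ofA C a, ofΓ C (C.d a); 0, ofA C a] := by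
  simp [diffHom]

lemma diffHom_ofΓ (ξ : Γ) : diffHom C (ofΓ C ξ) = !![-ofΓ C ξ, dΓ C ξ; 0, ofΓ C ξ] := by
  simp [diffHom]

/-- The differential of the envelope. -/
def diff : C.Envelope →ₗ[ℂ] C.Envelope where
  toFun x := diffHom C x 0 1
  map_add' x y := by simp
  map_smul' z x := by simp

@[simp] lemma diff_ofA (a : A) : diff C (ofA C a) = ofΓ C (C.d a) := by
  simp [diff, diffHom_ofA]

@[simp] lemma diff_ofΓ (ξ : Γ) : diff C (ofΓ C ξ) = dΓ C ξ := by
  simp [diff, diffHom_ofΓ]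

lemma diffHom_diag (n : ℕ) (x : C.Envelope) (hx : x ∈ deg C n) :
    diffHom C x 0 0 = (-1 : ℂ) ^ n • x ∧ diffHom C x 1 0 = 0 ∧ diffHom C x 1 1 = x := by
  induction n, x, hx using deg_induction C with
  | h0 n => simp
  | hA a => simp [diffHom_ofA]
  | hΓ ξ => simp [diffHom_ofΓ]
  | hadd n x y _ _ hx hy => simp [hx, hy]
  | hmul m n x y _ _ hx hy => simp [Matrix.mul_apply, hx, hy, smul_smul, pow_add, mul_comm]

lemma diff_mul (p : ℕ) (x : C.Envelope) (hx : x ∈ deg C p) (y : C.Envelope) :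
    diff C (x * y) = diff C x * y + (-1 : ℂ) ^ p • (x * diff C y) := by
  induction y using graded_induction (deg C) with
  | h n y hy =>
    simp [diff, Matrix.mul_apply, diffHom_diag C p x hx, diffHom_diag C n y hy, add_comm]
  | hadd y y' h h' => simp only [mul_add, map_add, h, h', smul_add]; abel

lemma dΓ_mem (ξ : Γ) : dΓ C ξ ∈ deg C 2 := by
  induction ξ using C.induction with
  | h a b => rw [dΓ_smul_d]; exact SetLike.mul_mem_graded (ofΓ_mem C _) (ofΓ_mem C _)
  | hadd x y hx hy => rw [map_add]; exact add_mem hx hy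

lemma diff_mem (n : ℕ) (x : C.Envelope) (hx : x ∈ deg C n) : diff C x ∈ deg C (n + 1) := by
  induction n, x, hx using deg_induction C with
  | h0 n => simp
  | hA a => simpa using ofΓ_mem C _
  | hΓ ξ => simpa using dΓ_mem C ξ
  | hadd n x y _ _ hx hy => rw [map_add]; exact add_mem hx hy
  | hmul m n x y hmx hmy hx hy =>
    rw [diff_mul C m x hmx]
    refine add_mem ?_ (Submodule.smul_mem _ _ ?_)
    · have h := SetLike.mul_mem_graded hx hmy
      rwa [add_right_comm] at h
    · have h := SetLike.mul_mem_graded hmx hy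
      rwa [← add_assoc] at h

lemma diff_dΓ (ξ : Γ) : diff C (dΓ C ξ) = 0 := by
  induction ξ using C.induction with
  | h a b =>
    rw [dΓ_smul_d, diff_mul C 1 _ (ofΓ_mem C _), diff_ofΓ, diff_ofΓ, dΓ_d, dΓ_d]
    simp
  | hadd x y hx hy => rw [map_add, map_add, hx, hy, add_zero]

lemma diff_diff (x : C.Envelope) : diff C (diff C x) = 0 := by
  induction x using graded_induction (deg C) with
  | hadd x y hx hy => rw [map_add, map_add, hx, hy, add_zero]
  | h n x hx =>
    induction n, x, hx using deg_induction C with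
    | h0 n => simp
    | hA a => simp [dΓ_d]
    | hΓ ξ => simp [diff_dΓ]
    | hadd n x y _ _ hx hy => rw [map_add, map_add, hx, hy, add_zero]
    | hmul m n x y hmx _ hx hy =>
      rw [diff_mul C m x hmx, map_add, map_smul, diff_mul C m x hmx,
        diff_mul C (m + 1) _ (diff_mem C m x hmx), hx, hy, pow_succ]
      simp

/-- The antilinear antihomomorphism of the envelope extending the involutions of `A` and `Γ`,
without the graded signs. -/
def dagger : C.Envelope →ₐ[ℂ] ConjOp C.Envelope :=
  lift C
    (AlgHom.ofLinearMap
      { toFun := fun a => toConjOp (ofA C (star a))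
        map_add' := fun a b => by simp
        map_smul' := fun z a => by
          rw [StarModule.star_smul, map_smul, toConjOp_smul, star_star, RingHom.id_apply] }
      (by simp [toConjOp_one])
      (fun a b => by
        change toConjOp _ = toConjOp _ * toConjOp _
        rw [star_mul, map_mul, toConjOp_mul]))
    { toFun := fun ξ => toConjOp (ofΓ C (star ξ))
      map_add' := fun a b => by simp
      map_smul' := fun z a => by
        rw [StarModule.star_smul, map_smul, toConjOp_smul, star_star, RingHom.id_apply] }
    (fun a ξ => by
      change toConjOp _ = toConjOp _ * toConjOp _
      rw [C.star_smul, ofΓ_op_smul, toConjOp_mul])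
    (fun ξ a => by
      change toConjOp _ = toConjOp _ * toConjOp _
      rw [C.star_op_smul, ofΓ_smul, toConjOp_mul])
    (fun t ht => by
      refine Eq.trans (b := toConjOp (-dΓ C (star (C.adb t)))) ?_ (by simp [ht])
      clear ht
      induction t with
      | zero => simp
      | add x y hx hy => rw [map_add, hx, hy, ← map_add]; simp [add_comm]
      | tmul a b =>
        change (toConjOp (ofΓ C (star (C.d a))) * toConjOp (ofΓ C (star (C.d b))) :
          ConjOp C.Envelope) = _
        rw [← toConjOp_mul, adb_tmul, C.star_smul_d, dΓ_op_smul, dΓ_d, C.star_d, C.star_d]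
        simp)

/-- The underlying additive map of `dagger`. -/
def dag : C.Envelope →+ C.Envelope :=
  (toConjOp.symm : ConjOp C.Envelope ≃+ C.Envelope).toAddMonoidHom.comp
    (dagger C : C.Envelope →+ ConjOp C.Envelope)

lemma dag_mul (x y : C.Envelope) : dag C (x * y) = dag C y * dag C x := by
  change toConjOp.symm (dagger C (x * y)) = _
  rw [map_mul, toConjOp_symm_mul]; rfl

lemma dag_smul (z : ℂ) (x : C.Envelope) : dag C (z • x) = star z • dag C x := by
  change toConjOp.symm (dagger C (z • x)) = _
  rw [map_smul, toConjOp_symm_smul]; rfl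

@[simp] lemma dag_ofA (a : A) : dag C (ofA C a) = ofA C (star a) := by
  change toConjOp.symm (dagger C (ofA C a)) = _
  simp [dagger]

@[simp] lemma dag_ofΓ (ξ : Γ) : dag C (ofΓ C ξ) = ofΓ C (star ξ) := by
  change toConjOp.symm (dagger C (ofΓ C ξ)) = _
  simp [dagger]

lemma dag_dag (x : C.Envelope) : dag C (dag C x) = x := by
  induction x using induction C with
  | hA a => simp
  | hΓ ξ => simp
  | hadd x y hx hy => simp [hx, hy]
  | hmul x y hx hy => simp [dag_mul, hx, hy]

lemma dag_mem (n : ℕ) (x : C.Envelope) (hx : x ∈ deg C n) : dag C x ∈ deg C n := by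
  induction n, x, hx using deg_induction C with
  | h0 n => simp
  | hA a => simpa using ofA_mem C _
  | hΓ ξ => simpa using ofΓ_mem C _
  | hadd n x y _ _ hx hy => rw [map_add]; exact add_mem hx hy
  | hmul m n x y _ _ hx hy =>
    rw [dag_mul, add_comm]; exact SetLike.mul_mem_graded hy hx

lemma dag_diff (n : ℕ) (x : C.Envelope) (hx : x ∈ deg C n) :
    dag C (diff C x) = (-1 : ℂ) ^ n • diff C (dag C x) := by
  induction n, x, hx using deg_induction C with
  | h0 n => simp
  | hA a => simp [C.star_d]
  | hΓ ξ =>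
    rw [diff_ofΓ, dag_ofΓ, diff_ofΓ]
    induction ξ using C.induction with
    | h a b =>
      rw [dΓ_smul_d, dag_mul, C.star_smul_d, dΓ_op_smul, dΓ_d]
      simp [C.star_d]
    | hadd x y hx hy => simp only [map_add, star_add, smul_add, hx, hy]
  | hadd n x y _ _ hx hy => simp only [map_add, hx, hy, smul_add]
  | hmul m n x y hmx hmy hx hy =>
    rw [diff_mul C m x hmx, map_add, dag_smul, dag_mul, dag_mul, dag_mul, hx, hy,
      diff_mul C n _ (dag_mem C n y hmy)]
    simp only [mul_smul_comm, smul_mul_assoc, smul_add, smul_smul, star_pow, star_neg, star_one,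
      ← pow_add]
    rw [add_comm]
    congr 2
    rw [add_assoc, ← two_mul n, pow_add, pow_mul]
    simp

/-- The sign `(-1)^{n(n-1)/2}` relating the graded and the ungraded involution in degree `n`. -/
def starSign (n : ℕ) : ℂ := (-1) ^ (n.choose 2)

lemma starSign_mul_self (n : ℕ) : starSign n * starSign n = 1 := by
  rw [starSign, ← mul_pow]; simp

lemma star_starSign (n : ℕ) : star (starSign n) = starSign n := by simp [starSign]

lemma starSign_add (m n : ℕ) : starSign (m + n) = starSign m * starSign n * (-1) ^ (m * n) := by
  rw [starSign, starSign, starSign, ← pow_add, ← pow_add]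
  congr 1
  induction n with
  | zero => simp
  | succ n ih => 
    rw [← add_assoc, Nat.choose_succ_succ' (m + n) 1, ih, Nat.choose_succ_succ' n 1]
    simp; ring

/-- The graded involution of the envelope. -/
instance : StarAddMonoid C.Envelope where
  star x := gradeScale (deg C) starSign (dag C x)
  star_involutive x := by
    induction x using graded_induction (deg C) with
    | h n x hx =>
      change gradeScale _ _ (dag C (gradeScale _ _ (dag C x))) = x
      rw [gradeScale_of_mem _ _ (dag_mem C n x hx), dag_smul, dag_dag, map_smul,
        gradeScale_of_mem _ _ hx, smul_smul, star_starSign, starSign_mul_self, one_smul]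
    | hadd x y hx hy =>
      change gradeScale _ _ (dag C (gradeScale _ _ (dag C (x + y)))) = x + y
      simp only [map_add]
      exact congrArg₂ (· + ·) hx hy
  star_add x y := by
    change gradeScale _ _ (dag C (x + y)) = gradeScale _ _ (dag C x) + gradeScale _ _ (dag C y)
    simp only [map_add]

instance : StarModule ℂ C.Envelope where
  star_smul z x := by
    change gradeScale _ _ (dag C (z • x)) = star z • gradeScale _ _ (dag C x)
    rw [dag_smul, map_smul]

lemma star_of_mem {n : ℕ} {x : C.Envelope} (hx : x ∈ deg C n) :
    star x = starSign n • dag C x :=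
  gradeScale_of_mem _ _ (dag_mem C n x hx)

lemma star_ofA (a : A) : star (ofA C a) = ofA C (star a) := by
  rw [star_of_mem C (ofA_mem C a)]; simp [starSign]

lemma star_ofΓ (ξ : Γ) : star (ofΓ C ξ) = ofΓ C (star ξ) := by
  rw [star_of_mem C (ofΓ_mem C ξ)]; simp [starSign]

/-- The graded-differential *-algebra structure of the universal differential envelope. -/
def gdStar : GDStarAlgebra C.Envelope where
  deg := deg C
  graded := graded C
  d := diff C
  d_mem := diff_mem C
  d_d := diff_diff C
  leibniz := diff_mul C
  star_mem n x hx := by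
    rw [star_of_mem C hx]; exact Submodule.smul_mem _ _ (dag_mem C n x hx)
  star_mul p q x hx y hy := by
    rw [star_of_mem C (SetLike.mul_mem_graded hx hy), star_of_mem C hx, star_of_mem C hy,
      dag_mul, starSign_add, smul_mul_smul_comm, smul_smul]
    congr 1; ring
  star_d x := by
    induction x using graded_induction (deg C) with
    | hadd x y hx hy => simp only [map_add, star_add, hx, hy]
    | h n x hx =>
      rw [star_of_mem C (diff_mem C n x hx), star_of_mem C hx, map_smul, dag_diff C n x hx,
        smul_smul, starSign_add, mul_one, mul_assoc, ← mul_pow]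
      simp [starSign]

end Envelope

end BicovariantCalculus

/-- A quantum principal bundle: *-algebras `V` of functions on the base and `B` of functions on the
total space, a unital *-monomorphism `i : V → B`, and a right coaction `F : B → B ⊗ A` by a unital
*-homomorphism, whose fixed-point subalgebra is `i(V)` and which is free in the sense that the map
`q ⊗ b ↦ q F(b)` is surjective. -/
structure QuantumPrincipalBundle (A V B : Type*) [Ring A] [HopfAlgebra ℂ A] [StarRing A]
    [StarModule ℂ A] [Ring V] [Algebra ℂ V] [StarRing V] [StarModule ℂ V]
    [Ring B] [Algebra ℂ B] [StarRing B] [StarModule ℂ B] where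
  i : V →⋆ₐ[ℂ] B
  i_injective : Function.Injective i
  F : B →⋆ₐ[ℂ] B ⊗[ℂ] A
  coassoc : ∀ b : B, TensorProduct.assoc ℂ B A A ((F : B →ₗ[ℂ] B ⊗[ℂ] A).rTensor A (F b)) =
    (Coalgebra.comul (R := ℂ) (A := A)).lTensor B (F b)
  counit : ∀ b : B, (Coalgebra.counit (R := ℂ) (A := A)).lTensor B (F b) = b ⊗ₜ 1
  fixed : ∀ b : B, F b = b ⊗ₜ 1 ↔ b ∈ Set.range i
  free : ∀ t : B ⊗[ℂ] A, t ∈ Submodule.span ℂ {s | ∃ q b : B, s = (q ⊗ₜ 1) * F b}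

/-- A differential calculus on a quantum principal bundle `P`, relative to the calculus `C` on the
structure group: a graded-differential *-algebra `Ω` with `Ω⁰ = B`, generated by `B` as a
differential algebra, such that the right action `F` extends to a homomorphism
`Ω → Ω ⊗̂ Γ^∧` of graded-differential *-algebras. -/
structure BundleCalculus {A Γ V B : Type*} [Ring A] [HopfAlgebra ℂ A] [StarRing A]
    [StarModule ℂ A] [AddCommGroup Γ] [Module ℂ Γ] [Module A Γ] [Module Aᵐᵒᵖ Γ]
    [IsScalarTower ℂ A Γ] [IsScalarTower ℂ Aᵐᵒᵖ Γ] [SMulCommClass A Aᵐᵒᵖ Γ]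
    [StarAddMonoid Γ] [StarModule ℂ Γ]
    [Ring V] [Algebra ℂ V] [StarRing V] [StarModule ℂ V]
    [Ring B] [Algebra ℂ B] [StarRing B] [StarModule ℂ B]
    (C : BicovariantCalculus A Γ) (P : QuantumPrincipalBundle A V B)
    (Ω : Type*) [Ring Ω] [Algebra ℂ Ω] [StarAddMonoid Ω] [StarModule ℂ Ω] where
  gd : GDStarAlgebra Ω
  incl : B →ₐ[ℂ] Ω
  incl_injective : Function.Injective incl
  range_incl : LinearMap.range incl.toLinearMap = gd.deg 0
  incl_star : ∀ b, incl (star b) = star (incl b)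
  generated : ∀ S : Subalgebra ℂ Ω, (∀ b, incl b ∈ S) → (∀ x ∈ S, gd.d x ∈ S) → S = ⊤
  action : Ω →ₐ[ℂ] gd.deg ᵍ⊗[ℂ] (BicovariantCalculus.Envelope.gdStar C).deg
  action_deg : ∀ n, ∀ x ∈ gd.deg n, (GradedTensorProduct.of ℂ _ _).symm (action x) ∈
    gd.tensorDeg (BicovariantCalculus.Envelope.gdStar C) n
  action_d : ∀ x, (GradedTensorProduct.of ℂ _ _).symm (action (gd.d x)) =
    gd.tensorD (BicovariantCalculus.Envelope.gdStar C)
      ((GradedTensorProduct.of ℂ _ _).symm (action x))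
  action_star : ∀ x, (GradedTensorProduct.of ℂ _ _).symm (action (star x)) =
    star ((GradedTensorProduct.of ℂ _ _).symm (action x))
  action_incl : ∀ b, (GradedTensorProduct.of ℂ _ _).symm (action (incl b)) =
    TensorProduct.map incl.toLinearMap (BicovariantCalculus.Envelope.ofA C).toLinearMap (P.F b)

section EmbeddedDifferential

variable {A Γ : Type*} [Ring A] [HopfAlgebra ℂ A] [StarRing A]
    [StarModule ℂ A] [AddCommGroup Γ] [Module ℂ Γ] [Module A Γ] [Module Aᵐᵒᵖ Γ]
    [IsScalarTower ℂ A Γ] [IsScalarTower ℂ Aᵐᵒᵖ Γ] [SMulCommClass A Aᵐᵒᵖ Γ]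
    [StarAddMonoid Γ] [StarModule ℂ Γ]

namespace BicovariantCalculus

/-- The adjoint action on `Γ_inv ⊗ Γ_inv`:
`ϑ ⊗ η ↦ ∑ ϑₖ ⊗ ηₗ ⊗ cₖ dₗ` if `ϖ(ϑ) = ∑ ϑₖ ⊗ cₖ` and `ϖ(η) = ∑ ηₗ ⊗ dₗ`. -/
def varpi₂ (C : BicovariantCalculus A Γ) :
    C.inv ⊗[ℂ] C.inv →ₗ[ℂ] (C.inv ⊗[ℂ] C.inv) ⊗[ℂ] A :=
  (LinearMap.mul' ℂ A).lTensor (C.inv ⊗[ℂ] C.inv) ∘ₗ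
    (TensorProduct.tensorTensorTensorComm ℂ C.inv A C.inv A).toLinearMap ∘ₗ
      TensorProduct.map C.varpi C.varpi

/-- The adjoint action on the tensor algebra `Γ_inv^⊗`, an algebra homomorphism. -/
def varpiT (C : BicovariantCalculus A Γ) :
    TensorAlgebra ℂ C.inv →ₐ[ℂ] TensorAlgebra ℂ C.inv ⊗[ℂ] A :=
  TensorAlgebra.lift ℂ ((TensorAlgebra.ι ℂ).rTensor A ∘ₗ C.varpi)

/-- The algebra `I` of invariant elements of `Γ_inv^⊗`. -/
def invariants (C : BicovariantCalculus A Γ) : Subalgebra ℂ (TensorAlgebra ℂ C.inv) :=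
  AlgHom.equalizer C.varpiT Algebra.TensorProduct.includeLeft

end BicovariantCalculus

/-- An embedded differential: a hermitian linear map `δ : Γ_inv → Γ_inv ⊗ Γ_inv` that intertwines
the adjoint actions and satisfies `d(ϑ) = ∑ ϑ¹ ϑ²` in the universal envelope if
`δ(ϑ) = ∑ ϑ¹ ⊗ ϑ²`. The involution of `Γ_inv ⊗ Γ_inv` is the graded one,
`(ϑ ⊗ η)* = -η* ⊗ ϑ*`. -/
structure EmbeddedDifferential [HopfStarAlgebra A] (C : BicovariantCalculus A Γ) where
  δ : C.inv →ₗ[ℂ] C.inv ⊗[ℂ] C.inv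
  lifts : ∀ ϑ : C.inv,
    LinearMap.mul' ℂ C.Envelope
      (TensorProduct.map (BicovariantCalculus.Envelope.ofΓ C ∘ₗ C.inv.subtype)
        (BicovariantCalculus.Envelope.ofΓ C ∘ₗ C.inv.subtype) (δ ϑ)) =
      (BicovariantCalculus.Envelope.gdStar C).d (BicovariantCalculus.Envelope.ofΓ C ϑ)
  intertwines : ∀ ϑ : C.inv, δ.rTensor A (C.varpi ϑ) = C.varpi₂ (δ ϑ)
  hermitian : ∀ ϑ : C.inv, δ (star ϑ) = -TensorProduct.comm ℂ C.inv C.inv (star (δ ϑ))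

end EmbeddedDifferential

/-- The antilinear antimultiplicative extension of the involution of `M` to the tensor algebra:
`(ϑ₁ ⊗ ⋯ ⊗ ϑₙ)* = ϑₙ* ⊗ ⋯ ⊗ ϑ₁*`. -/
def tensorStar {M : Type*} [AddCommGroup M] [Module ℂ M] [StarAddMonoid M] [StarModule ℂ M] :
    TensorAlgebra ℂ M →+ TensorAlgebra ℂ M :=
  (toConjOp.symm : ConjOp (TensorAlgebra ℂ M) ≃+ TensorAlgebra ℂ M).toAddMonoidHom.comp
    (TensorAlgebra.lift ℂ
      ({ toFun := fun m => toConjOp (TensorAlgebra.ι ℂ (star m))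
         map_add' := fun a b => by simp
         map_smul' := fun z a => by
          rw [StarModule.star_smul, map_smul, toConjOp_smul, star_star, RingHom.id_apply] } :
        M →ₗ[ℂ] ConjOp (TensorAlgebra ℂ M)) : TensorAlgebra ℂ M →+ ConjOp (TensorAlgebra ℂ M))

lemma tensorStar_mul {M : Type*} [AddCommGroup M] [Module ℂ M] [StarAddMonoid M] [StarModule ℂ M]
    (x y : TensorAlgebra ℂ M) : tensorStar (x * y) = tensorStar y * tensorStar x := by
  simp only [tensorStar, AddMonoidHom.comp_apply, AddMonoidHom.coe_coe, map_mul]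
  rfl

lemma tensorStar_ι {M : Type*} [AddCommGroup M] [Module ℂ M] [StarAddMonoid M] [StarModule ℂ M]
    (m : M) : tensorStar (TensorAlgebra.ι ℂ m) = TensorAlgebra.ι ℂ (star m) := by
  simp only [tensorStar, AddMonoidHom.comp_apply, AddMonoidHom.coe_coe, TensorAlgebra.lift_ι_apply]
  rfl

lemma tensorStar_smul {M : Type*} [AddCommGroup M] [Module ℂ M] [StarAddMonoid M]
    [StarModule ℂ M] (z : ℂ) (x : TensorAlgebra ℂ M) :
    tensorStar (z • x) = star z • tensorStar x := by
  simp only [tensorStar, AddMonoidHom.comp_apply, AddMonoidHom.coe_coe, map_smul]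
  rfl

namespace BundleCalculus

variable {A Γ V B Ω : Type*} [Ring A] [HopfAlgebra ℂ A] [StarRing A]
    [StarModule ℂ A] [AddCommGroup Γ] [Module ℂ Γ] [Module A Γ] [Module Aᵐᵒᵖ Γ]
    [IsScalarTower ℂ A Γ] [IsScalarTower ℂ Aᵐᵒᵖ Γ] [SMulCommClass A Aᵐᵒᵖ Γ]
    [StarAddMonoid Γ] [StarModule ℂ Γ]
    [Ring V] [Algebra ℂ V] [StarRing V] [StarModule ℂ V]
    [Ring B] [Algebra ℂ B] [StarRing B] [StarModule ℂ B]
    {C : BicovariantCalculus A Γ} {P : QuantumPrincipalBundle A V B}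
    [Ring Ω] [Algebra ℂ Ω] [StarAddMonoid Ω] [StarModule ℂ Ω] (X : BundleCalculus C P Ω)

/-- The map `F̂ : Ω(P) → Ω(P) ⊗ Γ^∧`, with values in the underlying tensor product of vector
spaces. -/
def hatF : Ω →ₗ[ℂ] Ω ⊗[ℂ] C.Envelope :=
  (GradedTensorProduct.of ℂ X.gd.deg
    (BicovariantCalculus.Envelope.gdStar C).deg).symm.toLinearMap ∘ₗ X.action.toLinearMap

/-- The right action `F^∧ = (id ⊗ p_*) F̂` of the structure group on `Ω(P)`. -/
def wedgeF : Ω →ₗ[ℂ] Ω ⊗[ℂ] A :=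
  (BicovariantCalculus.Envelope.proj C).toLinearMap.lTensor Ω ∘ₗ X.hatF

/-- The horizontal forms `F̂⁻¹(Ω(P) ⊗ A)`. -/
def hor : Submodule ℂ Ω :=
  (LinearMap.range ((BicovariantCalculus.Envelope.ofA C).toLinearMap.lTensor Ω)).comap X.hatF

/-- The differential forms on the base: the `F̂`-invariant forms. -/
def baseForms : Subalgebra ℂ Ω :=
  AlgHom.equalizer X.action (GradedTensorProduct.includeLeft _ _)

lemma mem_baseForms {x : Ω} : x ∈ X.baseForms ↔ X.hatF x = x ⊗ₜ 1 := by
  change X.action x = GradedTensorProduct.of ℂ _ _ (x ⊗ₜ 1) ↔ _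
  rw [← LinearEquiv.symm_apply_eq]
  rfl

lemma d_mem_baseForms {x : Ω} (hx : x ∈ X.baseForms) : X.gd.d x ∈ X.baseForms := by
  rw [mem_baseForms] at hx ⊢
  refine (X.action_d x).trans ?_
  change X.gd.tensorD _ (X.hatF x) = _
  rw [hx, GDStarAlgebra.tensorD]
  simp [GDStarAlgebra.d_one]

lemma star_mem_baseForms {x : Ω} (hx : x ∈ X.baseForms) : star x ∈ X.baseForms := by
  rw [mem_baseForms] at hx ⊢
  refine (X.action_star x).trans ?_
  change star (X.hatF x) = _
  rw [hx, TensorProduct.star_tmul, ← map_one (BicovariantCalculus.Envelope.ofA C),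
    BicovariantCalculus.Envelope.star_ofA, star_one]

lemma tensorSgn_of_mem (n : ℕ) (t : Ω ⊗[ℂ] C.Envelope)
    (ht : t ∈ X.gd.tensorDeg (BicovariantCalculus.Envelope.gdStar C) n) :
    TensorProduct.map X.gd.sgn (BicovariantCalculus.Envelope.gdStar C).sgn t =
      (-1 : ℂ) ^ n • t := by
  have h : X.gd.tensorDeg (BicovariantCalculus.Envelope.gdStar C) n ≤
      LinearMap.eqLocus (TensorProduct.map X.gd.sgn (BicovariantCalculus.Envelope.gdStar C).sgn)
        ((-1 : ℂ) ^ n • LinearMap.id) := by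
    refine iSup_le fun p => iSup_le fun q => iSup_le fun hpq => ?_
    rintro _ ⟨s, rfl⟩
    induction s with
    | zero => simp
    | add s s' h h' => rw [map_add]; exact add_mem h h'
    | tmul x y =>
      simp only [LinearMap.mem_eqLocus, TensorProduct.map_tmul, Submodule.subtype_apply,
        GDStarAlgebra.sgn_of_mem _ x.2, GDStarAlgebra.sgn_of_mem _ y.2]
      rw [TensorProduct.smul_tmul_smul, ← pow_add, hpq]
      rfl
  exact h ht

lemma sgn_mem_baseForms {x : Ω} (hx : x ∈ X.baseForms) : X.gd.sgn x ∈ X.baseForms := by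
  have h : ∀ x, X.hatF (X.gd.sgn x) =
      TensorProduct.map X.gd.sgn (BicovariantCalculus.Envelope.gdStar C).sgn (X.hatF x) := by
    intro x
    induction x using graded_induction X.gd.deg with
    | hadd x y hx hy => simp only [map_add, hx, hy]
    | h n x hx =>
      rw [X.gd.sgn_of_mem hx, map_smul]
      exact (X.tensorSgn_of_mem n _ (X.action_deg n x hx)).symm
  rw [mem_baseForms] at hx ⊢
  rw [h, hx, TensorProduct.map_tmul, GDStarAlgebra.sgn_of_mem _ SetLike.GradedOne.one_mem]
  simp

/-- The closed forms on the base. -/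
def cocycles : Subalgebra ℂ Ω where
  carrier := {x | x ∈ X.baseForms ∧ X.gd.d x = 0}
  mul_mem' {x y} hx hy := ⟨mul_mem hx.1 hy.1, by rw [X.gd.d_mul, hx.2, hy.2]; simp⟩
  add_mem' {x y} hx hy := ⟨add_mem hx.1 hy.1, by rw [map_add, hx.2, hy.2, add_zero]⟩
  algebraMap_mem' z := ⟨algebraMap_mem _ z, by
    rw [Algebra.algebraMap_eq_smul_one, map_smul, X.gd.d_one, smul_zero]⟩

/-- The exact forms on the base, as an ideal of the algebra of closed forms. -/
def coboundaries : Ideal X.cocycles where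
  carrier := {z | ∃ η ∈ X.baseForms, X.gd.d η = z}
  add_mem' := by
    rintro _ _ ⟨η, hη, h⟩ ⟨η', hη', h'⟩
    exact ⟨η + η', add_mem hη hη', by rw [map_add, h, h']; rfl⟩
  zero_mem' := ⟨0, zero_mem _, by simp⟩
  smul_mem' := by
    rintro z _ ⟨η, hη, h⟩
    refine ⟨X.gd.sgn z * η, mul_mem (X.sgn_mem_baseForms z.2.1) hη, ?_⟩
    rw [X.gd.d_mul, X.gd.d_sgn, z.2.2, X.gd.sgn_sgn, h]
    simp

instance : X.coboundaries.IsTwoSided where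
  mul_mem_of_left := by
    rintro _ z ⟨η, hη, h⟩
    exact ⟨η * z, mul_mem hη z.2.1, by rw [X.gd.d_mul, z.2.2, h]; simp⟩

/-- The cohomology algebra `H(M)` of the base. -/
abbrev Cohomology : Type _ := X.cocycles ⧸ X.coboundaries

/-- The cohomology class of a closed form. -/
def cls : X.cocycles →ₐ[ℂ] X.Cohomology := Ideal.Quotient.mkₐ ℂ X.coboundaries

/-- The involution of `H(M)`, `[x]* = [x*]`. -/
def starH : X.Cohomology →+ X.Cohomology :=
  QuotientAddGroup.map _ _
    { toFun := fun z => ⟨star (z : Ω), X.star_mem_baseForms z.2.1, by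
        rw [← X.gd.star_d, z.2.2, star_zero]⟩
      map_zero' := Subtype.ext (star_zero Ω)
      map_add' := fun x y => Subtype.ext (star_add (x : Ω) (y : Ω)) }
    (by
      rintro z ⟨η, hη, h⟩
      exact ⟨star η, X.star_mem_baseForms hη, by rw [← X.gd.star_d, h]; rfl⟩)

/-- Connections: hermitian linear maps `ω : Γ_inv → Ω¹(P)` with
`F̂ ω(ϑ) = ∑ ω(ϑₖ) ⊗ cₖ + 1 ⊗ ϑ`, where `ϖ(ϑ) = ∑ ϑₖ ⊗ cₖ`. -/
structure IsConnection [HopfStarAlgebra A] (ω : C.inv →ₗ[ℂ] Ω) : Prop where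
  deg_one : ∀ ϑ, ω ϑ ∈ X.gd.deg 1
  hermitian : ∀ ϑ, ω (star ϑ) = star (ω ϑ)
  hatF : ∀ ϑ : C.inv, X.hatF (ω ϑ) =
    TensorProduct.map ω (BicovariantCalculus.Envelope.ofA C).toLinearMap (C.varpi ϑ) +
      1 ⊗ₜ BicovariantCalculus.Envelope.ofΓ C ϑ

/-- Pseudotensorial `n`-forms of type `ϖ`: linear maps `Γ_inv → Ωⁿ(P)` that intertwine `ϖ` and
`F^∧`. -/
structure IsPseudotensorial (n : ℕ) (φ : C.inv →ₗ[ℂ] Ω) : Prop where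
  deg_mem : ∀ ϑ, φ ϑ ∈ X.gd.deg n
  wedgeF : ∀ ϑ : C.inv, X.wedgeF (φ ϑ) = φ.rTensor A (C.varpi ϑ)

variable [HopfStarAlgebra A] (δ : EmbeddedDifferential C)

/-- The bracket `⟨φ, ψ⟩(ϑ) = ∑ φ(ϑ¹) ψ(ϑ²)`, where `δ(ϑ) = ∑ ϑ¹ ⊗ ϑ²`. -/
def bracket (φ ψ : C.inv →ₗ[ℂ] Ω) : C.inv →ₗ[ℂ] Ω :=
  LinearMap.mul' ℂ Ω ∘ₗ TensorProduct.map φ ψ ∘ₗ δ.δ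

/-- The curvature `R_ω = d ω - ⟨ω, ω⟩`. -/
def curvature (ω : C.inv →ₗ[ℂ] Ω) : C.inv →ₗ[ℂ] Ω := X.gd.d ∘ₗ ω - bracket δ ω ω

/-- The unital multiplicative extension `R_ω^⊗ : Γ_inv^⊗ → Ω(P)` of the curvature. Its restriction
to the invariant elements is `W^ω`. -/
def weilForm (ω : C.inv →ₗ[ℂ] Ω) : TensorAlgebra ℂ C.inv →ₐ[ℂ] Ω :=
  TensorAlgebra.lift ℂ (X.curvature δ ω)

/-- The two-sided ideal `𝒦_ω` of `Ω(P)` generated by the elements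
`⟨ω, φ⟩(ϑ) - (-1)^{|φ|} ⟨φ, ω⟩(ϑ)` with `φ` pseudotensorial of type `ϖ`. -/
def idealK (ω : C.inv →ₗ[ℂ] Ω) : TwoSidedIdeal Ω :=
  TwoSidedIdeal.span {x | ∃ (n : ℕ) (φ : C.inv →ₗ[ℂ] Ω) (ϑ : C.inv), X.IsPseudotensorial n φ ∧
    x = bracket δ ω φ ϑ - (-1 : ℂ) ^ n • bracket δ φ ω ϑ}

/-- The splitting condition `hor(P) ∩ 𝒦_ω = {0}`. -/
def Splitting (ω : C.inv →ₗ[ℂ] Ω) : Prop := ∀ x ∈ X.hor, x ∈ X.idealK δ ω → x = 0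

end BundleCalculus

end

end QuantumBundle

open QuantumBundle

/-! Everything rests on two facts about the curvature: it is tensorial, and it is closed modulo
`𝒦_ω`.

Tensoriality (`curvature_isTensorial`). The coproduct extends to a homomorphism `Γ^∧ → Γ^∧ ⊗̂ Γ^∧`
(`comulHat`). On `Γ_inv` it is `ϑ ↦ ∑ ϑₖ ⊗ cₖ + 1 ⊗ ϑ`, the transformation law of a connection.
Applied to `d(ϑ) = ∑ ϑ¹ ϑ²`, its component of bidegree `(1, 1)` gives an identity in `Γ_inv ⊗ Γ^∧`
(`mixed_of_lifts`) which involves no bundle. Transported by `ω`, it says that the mixed terms of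
`F̂⟨ω, ω⟩` equal those of `F̂ dω`; the terms `1 ⊗ dϑ` cancel too. Hence `R_ω^⊗` intertwines `F̂`
with the adjoint action and sends invariant tensors to forms on the base.

Closedness. Since `ω` is itself pseudotensorial of degree one, `2⟨ω, ω⟩ ∈ 𝒦_ω`. Substituting `dω =
R_ω + ⟨ω, ω⟩` in `-d⟨ω, ω⟩` gives `dR_ω = ⟨ω, R_ω⟩ - ⟨R_ω, ω⟩` modulo `𝒦_ω`, and the right side is a
generator. So `dW^ω(ϑ)` lies in `𝒦_ω`; for invariant `ϑ` it is also a form on the base, hence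
horizontal, and the splitting condition makes it vanish.

Independence of `ω` (`exists_transgression`). Put `ω_t = ω + tφ` with `φ` the difference of two
connections, which is tensorial. Modulo `𝒦_{ω_t}` the derivative of the curvature is `dφ`, so the
derivative of `W^{ω_t}(ϑ)` is `d` of the form obtained by replacing one factor `R` at a time by `φ`.
Both sides are forms on the base, so the splitting condition for `ω_t` turns the congruence into an
equality. All is polynomial in `t`, so integration over `[0, 1]` is division of coefficients by `n +
1`.

Involution. The curvature is hermitian and its products have even degree, so the graded involution
of `Ω(P)` acts on them without signs (`weilForm_star`). -/

namespace QuantumBundle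

noncomputable section

/-! ### Degree one of the universal envelope -/

/-- The degree one part of the universal envelope is the calculus: a linear retraction of `ofΓ`
vanishing in the other degrees. -/
def BicovariantCalculus.Envelope.toΓ {A Γ : Type*} [Ring A] [HopfAlgebra ℂ A] [StarRing A]
    [StarModule ℂ A] [AddCommGroup Γ] [Module ℂ Γ] [Module A Γ] [Module Aᵐᵒᵖ Γ]
    [IsScalarTower ℂ A Γ] [IsScalarTower ℂ Aᵐᵒᵖ Γ] [SMulCommClass A Aᵐᵒᵖ Γ]
    [StarAddMonoid Γ] [StarModule ℂ Γ] (C : BicovariantCalculus A Γ) : C.Envelope →ₗ[ℂ] Γ :=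
  ((TrivSqZeroExt.sndHom A Γ).restrictScalars ℂ) ∘ₗ
    -- In the square-zero extension of `A` by `Γ` all products of two elements of `Γ` vanish, so the
    -- quadratic relations hold automatically.
    (lift C (TrivSqZeroExt.inlAlgHom ℂ A Γ) ((TrivSqZeroExt.inrHom A Γ).restrictScalars ℂ)
      (fun a ξ => by ext <;> simp) (fun ξ a => by ext <;> simp)
      (fun t ht => by
        clear ht
        induction t with
        | zero => simp
        | add x y hx hy => rw [map_add, hx, hy, add_zero]
        | tmul a b => simp)).toLinearMap

namespace BicovariantCalculus

variable {A Γ : Type*} [Ring A] [HopfAlgebra ℂ A] [StarRing A]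
    [StarModule ℂ A] [AddCommGroup Γ] [Module ℂ Γ] [Module A Γ] [Module Aᵐᵒᵖ Γ]
    [IsScalarTower ℂ A Γ] [IsScalarTower ℂ Aᵐᵒᵖ Γ] [SMulCommClass A Aᵐᵒᵖ Γ]
    [StarAddMonoid Γ] [StarModule ℂ Γ] (C : BicovariantCalculus A Γ)

namespace Envelope

@[simp] lemma toΓ_ofA (a : A) : toΓ C (ofA C a) = 0 := by
  simp [toΓ]

@[simp] lemma toΓ_ofΓ (ξ : Γ) : toΓ C (ofΓ C ξ) = ξ := by
  simp [toΓ]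

@[simp] lemma toΓ_ofΓ_mul_ofΓ (ξ η : Γ) : toΓ C (ofΓ C ξ * ofΓ C η) = 0 := by
  simp [toΓ]

@[simp] lemma toΓ_dΓ (ξ : Γ) : toΓ C (dΓ C ξ) = 0 := by
  induction ξ using C.induction with
  | h a b => rw [dΓ_smul_d, toΓ_ofΓ_mul_ofΓ]
  | hadd x y hx hy => rw [map_add, map_add, hx, hy, add_zero]

end Envelope

open Envelope

/-! ### Koszul signs in `Ω ⊗̂ Γ^∧` -/

section GradedTensor

variable {Ω : Type*} [Ring Ω] [Algebra ℂ Ω] [StarAddMonoid Ω] [StarModule ℂ Ω]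
  (S : GDStarAlgebra Ω)

/-- The graded tensor product of a graded-differential *-algebra with the envelope. -/
abbrev GTensor : Type _ := S.deg ᵍ⊗[ℂ] (gdStar C).deg

/-- The identification of the vector spaces underlying `Ω ⊗ Γ^∧` and `Ω ⊗̂ Γ^∧`. -/
abbrev toG : Ω ⊗[ℂ] C.Envelope ≃ₗ[ℂ] C.GTensor S := GradedTensorProduct.of ℂ S.deg (gdStar C).deg

lemma toG_mul_toG {i j : ℕ} (x : Ω) {a : C.Envelope} (ha : a ∈ (gdStar C).deg i) {y : Ω}
    (hy : y ∈ S.deg j) (b : C.Envelope) :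
    C.toG S (x ⊗ₜ a) * C.toG S (y ⊗ₜ b) = (-1 : ℂ) ^ (i * j) • C.toG S ((x * y) ⊗ₜ (a * b)) := by
  refine (GradedTensorProduct.tmul_coe_mul_coe_tmul S.deg (gdStar C).deg x ⟨a, ha⟩
    ⟨y, hy⟩ b).trans ?_
  rcases Nat.even_or_odd (i * j) with h | h
  · have h' : (-1 : ℂ) ^ (i * j) = 1 := h.neg_one_pow
    rw [h.neg_one_pow, one_smul, h', one_smul]
  · have h' : (-1 : ℂ) ^ (i * j) = -1 := h.neg_one_pow
    rw [h.neg_one_pow, h', Units.neg_smul, one_smul, neg_one_smul]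

lemma toG_ofA_mul (x : Ω) (a : A) (y : Ω) (b : C.Envelope) :
    C.toG S (x ⊗ₜ ofA C a) * C.toG S (y ⊗ₜ b) = C.toG S ((x * y) ⊗ₜ (ofA C a * b)) := by
  induction y using graded_induction S.deg with
  | h n y hy => rw [C.toG_mul_toG S x (ofA_mem C a) hy]; simp
  | hadd y y' h h' => simp only [TensorProduct.add_tmul, map_add, mul_add, h, h']

lemma toG_mul_deg_zero (x : Ω) (a : C.Envelope) {y : Ω} (hy : y ∈ S.deg 0) (b : C.Envelope) :
    C.toG S (x ⊗ₜ a) * C.toG S (y ⊗ₜ b) = C.toG S ((x * y) ⊗ₜ (a * b)) := by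
  induction a using graded_induction (gdStar C).deg with
  | h n a ha => rw [C.toG_mul_toG S x ha hy]; simp
  | hadd a a' h h' => simp only [TensorProduct.tmul_add, map_add, add_mul, h, h']

lemma toG_mul_deg_one (x : Ω) (ξ : Γ) {y : Ω} (hy : y ∈ S.deg 1) (b : C.Envelope) :
    C.toG S (x ⊗ₜ ofΓ C ξ) * C.toG S (y ⊗ₜ b) = -C.toG S ((x * y) ⊗ₜ (ofΓ C ξ * b)) := by
  rw [C.toG_mul_toG S x (ofΓ_mem C ξ) hy]; simp

end GradedTensor

/-! ### Extension of the coproduct to the universal envelope -/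

/-- The differential of `Γ^∧ ⊗̂ Γ^∧`. -/
def gD : C.GTensor (gdStar C) →ₗ[ℂ] C.GTensor (gdStar C) :=
  (C.toG (gdStar C)).toLinearMap ∘ₗ (gdStar C).tensorD (gdStar C) ∘ₗ
    (C.toG (gdStar C)).symm.toLinearMap

lemma gD_toG (t : C.Envelope ⊗[ℂ] C.Envelope) :
    C.gD (C.toG _ t) = C.toG _ ((gdStar C).tensorD (gdStar C) t) := rfl

lemma gD_gD (t) : C.gD (C.gD t) = 0 := by
  obtain ⟨t, rfl⟩ := (C.toG (gdStar C)).surjective t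
  rw [gD_toG, gD_toG, LinearEquiv.map_eq_zero_iff]
  induction t with
  | zero => simp
  | add x y hx hy => rw [map_add, map_add, hx, hy, add_zero]
  | tmul x y =>
    simp only [GDStarAlgebra.tensorD, LinearMap.add_apply, TensorProduct.map_tmul, map_add,
      LinearMap.id_apply, GDStarAlgebra.d_d, GDStarAlgebra.d_sgn]
    simp [TensorProduct.neg_tmul]

/-- The embedding of `A ⊗ A` in `Γ^∧ ⊗̂ Γ^∧`. -/
def ofAA : A ⊗[ℂ] A →ₗ[ℂ] C.GTensor (gdStar C) :=
  (C.toG (gdStar C)).toLinearMap ∘ₗ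
    TensorProduct.map (ofA C).toLinearMap (ofA C).toLinearMap

lemma ofAA_mul (x y : A ⊗[ℂ] A) : C.ofAA (x * y) = C.ofAA x * C.ofAA y := by
  induction x with
  | zero => simp
  | add u u' h h' => simp only [map_add, add_mul, h, h']
  | tmul x a =>
    induction y with
    | zero => simp
    | add v v' h h' => simp only [map_add, mul_add, h, h']
    | tmul y b => simp [ofAA, toG_ofA_mul]

/-- This is the only case of the graded Leibniz rule that is needed: the left factor has degree
zero. The Koszul sign from moving `d a` past `y` agrees with the sign that the differential of the
tensor product attaches to the first factor. -/
lemma gD_ofAA_mul (x : A ⊗[ℂ] A) (v : C.GTensor (gdStar C)) :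
    C.gD (C.ofAA x * v) = C.gD (C.ofAA x) * v + C.ofAA x * C.gD v := by
  obtain ⟨v, rfl⟩ := (C.toG (gdStar C)).surjective v
  induction x with
  | zero => simp
  | add u u' h h' => simp only [map_add, add_mul, h, h']; abel
  | tmul x a =>
    induction v with
    | zero => simp
    | add v v' h h' => simp only [map_add, mul_add, h, h']; abel
    | tmul y b =>
      induction y using graded_induction (gdStar C).deg with
      | hadd y y' h h' => simp only [TensorProduct.add_tmul, map_add, mul_add, h, h']; abel
      | h n y hy =>
        have h1 : C.ofAA (x ⊗ₜ a) = C.toG (gdStar C) (ofA C x ⊗ₜ ofA C a) := rfl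
        have hs : (gdStar C).sgn (ofA C x) = ofA C x := by
          rw [(gdStar C).sgn_of_mem (ofA_mem C x)]; simp
        have hs' : (gdStar C).sgn (ofA C x * y) = (-1 : ℂ) ^ n • (ofA C x * y) := by
          have := SetLike.mul_mem_graded (A := (gdStar C).deg) (ofA_mem C x) hy
          rw [zero_add] at this
          exact (gdStar C).sgn_of_mem this
        have hd : (gdStar C).d (ofA C a) = ofΓ C (C.d a) := diff_ofA C a
        have h2 : C.toG (gdStar C) (ofA C x ⊗ₜ ofΓ C (C.d a)) * C.toG (gdStar C) (y ⊗ₜ b) =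
            (-1 : ℂ) ^ n • C.toG (gdStar C) ((ofA C x * y) ⊗ₜ (ofΓ C (C.d a) * b)) := by
          rw [C.toG_mul_toG _ _ (ofΓ_mem C _) hy, one_mul]
        have h3 : C.toG (gdStar C) ((gdStar C).d (ofA C x) ⊗ₜ ofA C a) * C.toG (gdStar C) (y ⊗ₜ b) =
            C.toG (gdStar C) (((gdStar C).d (ofA C x) * y) ⊗ₜ (ofA C a * b)) := by
          rw [toG_ofA_mul]
        rw [h1, toG_ofA_mul, gD_toG, gD_toG, gD_toG]
        simp only [GDStarAlgebra.tensorD, LinearMap.add_apply, TensorProduct.map_tmul, map_add,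
          LinearMap.id_apply, GDStarAlgebra.d_mul, hs, hs', (gdStar C).sgn_of_mem hy, hd,
          mul_add, add_mul, h2, h3, toG_ofA_mul, TensorProduct.add_tmul, TensorProduct.tmul_add]
        rw [(gdStar C).sgn_of_mem (ofA_mem C a)]
        simp only [← TensorProduct.smul_tmul', map_smul, mul_smul_comm, pow_zero, one_smul]
        abel

/-- The degree zero part of the extended coproduct. -/
def comulHatA : A →ₐ[ℂ] C.GTensor (gdStar C) :=
  AlgHom.ofLinearMap (C.ofAA ∘ₗ Coalgebra.comul)
    (by
      rw [LinearMap.comp_apply, Bialgebra.comul_one, Algebra.TensorProduct.one_def]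
      simp only [ofAA, LinearMap.comp_apply, TensorProduct.map_tmul, AlgHom.toLinearMap_apply,
        map_one]
      rfl)
    (fun a b => by simp only [LinearMap.comp_apply, Bialgebra.comul_mul, ofAA_mul])

/-- The degree one part of the extended coproduct. -/
def comulHatΓ : Γ →ₗ[ℂ] C.GTensor (gdStar C) :=
  (C.toG (gdStar C)).toLinearMap ∘ₗ
    (TensorProduct.map (ofΓ C) (ofA C).toLinearMap ∘ₗ C.rightAction +
      TensorProduct.map (ofA C).toLinearMap (ofΓ C) ∘ₗ C.leftAction)

/-- The right and left actions on `a d(b)` apply `d` to one leg of the coproduct of `b`. Their sum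
is the full differential of that coproduct, which is why `comulHatΓ` is their sum. -/
lemma toG_actL (x y : A ⊗[ℂ] A) : C.toG (gdStar C) (TensorProduct.map (ofΓ C) (ofA C).toLinearMap
      (actL A Γ x (C.d.rTensor A y))) +
      C.toG (gdStar C) (TensorProduct.map (ofA C).toLinearMap (ofΓ C)
      (actR A Γ x (C.d.lTensor A y))) = C.ofAA x * C.gD (C.ofAA y) := by
  induction x with
  | zero => simp
  | add u u' h h' =>
    simp only [map_add, add_mul, ← h, ← h', LinearMap.add_apply]; abel
  | tmul x a =>
    induction y with
    | zero => simp
    | add v v' h h' =>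
      simp only [map_add, mul_add, ← h, ← h']; abel
    | tmul y b =>
      have h1 (x a : A) : C.ofAA (x ⊗ₜ a) = C.toG (gdStar C) (ofA C x ⊗ₜ ofA C a) := rfl
      have hd (a : A) : (gdStar C).d (ofA C a) = ofΓ C (C.d a) := diff_ofA C a
      have hs : (gdStar C).sgn (ofA C y) = ofA C y := by
        rw [(gdStar C).sgn_of_mem (ofA_mem C y)]; simp
      rw [h1, h1, gD_toG]
      simp [GDStarAlgebra.tensorD, hd, hs, mul_add, toG_ofA_mul, ofΓ_smul]

lemma comulHatΓ_smul_d (a b : A) :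
    C.comulHatΓ (a • C.d b) = C.comulHatA a * C.gD (C.comulHatA b) := by
  change C.toG _ (_ + _) = C.ofAA _ * C.gD (C.ofAA _)
  rw [map_add, ← toG_actL, LinearMap.comp_apply, LinearMap.comp_apply, C.leftAction_smul_d,
    C.rightAction_smul_d]

lemma comulHatΓ_d (b : A) : C.comulHatΓ (C.d b) = C.gD (C.comulHatA b) := by
  simpa using C.comulHatΓ_smul_d 1 b

lemma gD_comulHatA_mul (a : A) (v : C.GTensor (gdStar C)) :
    C.gD (C.comulHatA a * v) = C.gD (C.comulHatA a) * v + C.comulHatA a * C.gD v :=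
  C.gD_ofAA_mul _ _

/-- With `D` the total differential and `Δ` the coproduct, `D(Δ(a) DΔ(b)) = DΔ(a) DΔ(b)` because `D²
= 0`. The left side depends only on `a d(b)`, so the extended coproduct respects the quadratic
relations of the envelope. -/
lemma gD_comulHatΓ_adb (t : A ⊗[ℂ] A) : TensorProduct.lift ((LinearMap.mul ℂ _).compl₁₂
    (C.comulHatΓ ∘ₗ C.d) (C.comulHatΓ ∘ₗ C.d)) t = C.gD (C.comulHatΓ (C.adb t)) := by
  induction t with
  | zero => simp
  | add x y hx hy => rw [map_add, hx, hy, map_add, map_add, map_add]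
  | tmul a b =>
    simp [comulHatΓ_smul_d, gD_comulHatA_mul, gD_gD, comulHatΓ_d]

/-- The coproduct of `A`, extended to the universal envelope. -/
def comulHat : C.Envelope →ₐ[ℂ] C.GTensor (gdStar C) :=
  lift C C.comulHatA C.comulHatΓ
    (fun a ξ => by
      induction ξ using C.induction with
      | h b c => rw [← mul_smul, comulHatΓ_smul_d, comulHatΓ_smul_d, map_mul, mul_assoc]
      | hadd x y hx hy => rw [smul_add, map_add, hx, hy, map_add, mul_add])
    (fun ξ a => by
      induction ξ using C.induction with
      | h b c =>
        have h : op a • (b • C.d c) = b • C.d (c * a) - (b * c) • C.d a := by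
          rw [C.leibniz, smul_add, mul_smul, add_sub_cancel_left, ← smul_comm]
        rw [h, map_sub, comulHatΓ_smul_d, comulHatΓ_smul_d, comulHatΓ_smul_d, map_mul C.comulHatA,
          map_mul C.comulHatA,
          gD_comulHatA_mul]
        noncomm_ring
      | hadd x y hx hy => rw [smul_add, map_add, hx, hy, map_add, add_mul])
    (fun t ht => by rw [gD_comulHatΓ_adb, ht, map_zero, map_zero])

lemma comulHat_ofΓ (ξ : Γ) : C.comulHat (ofΓ C ξ) = C.comulHatΓ ξ := lift_ofΓ _ _ _ _ _ _ _

/-- Compatibility with the differentials on `Γ` suffices, since it is used only for `d(ϑ)` with `ϑ`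
left-invariant. -/
lemma comulHat_dΓ (ξ : Γ) : C.comulHat (dΓ C ξ) = C.gD (C.comulHatΓ ξ) := by
  obtain ⟨t, rfl⟩ := C.adb_surjective ξ
  rw [dΓ_adb, ← gD_comulHatΓ_adb]
  induction t with
  | zero => simp
  | add x y hx hy => rw [map_add, map_add, hx, hy, map_add]
  | tmul a b => simp [comulHat_ofΓ]

end BicovariantCalculus

end

end QuantumBundle

/-! ### The transformation law of a connection and the embedded differential -/

namespace QuantumBundle

noncomputable section

lemma map_sub_left {M N M' N' : Type*} [AddCommGroup M] [Module ℂ M] [AddCommGroup N] [Module ℂ N]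
    [AddCommGroup M'] [Module ℂ M'] [AddCommGroup N'] [Module ℂ N'] (f g : M →ₗ[ℂ] M')
    (h : N →ₗ[ℂ] N') :
    TensorProduct.map (f - g) h = TensorProduct.map f h - TensorProduct.map g h := by
  ext x y
  simp [TensorProduct.sub_tmul]

namespace BicovariantCalculus

open Envelope

variable {A Γ : Type*} [Ring A] [HopfAlgebra ℂ A] [StarRing A]
    [StarModule ℂ A] [AddCommGroup Γ] [Module ℂ Γ] [Module A Γ] [Module Aᵐᵒᵖ Γ]
    [IsScalarTower ℂ A Γ] [IsScalarTower ℂ Aᵐᵒᵖ Γ] [SMulCommClass A Aᵐᵒᵖ Γ]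
    [StarAddMonoid Γ] [StarModule ℂ Γ] (C : BicovariantCalculus A Γ)

/-- The inclusion of the left-invariant part in the envelope. -/
def ofInv : C.inv →ₗ[ℂ] C.Envelope := ofΓ C ∘ₗ C.inv.subtype

@[simp] lemma ofInv_apply (ϑ : C.inv) : C.ofInv ϑ = ofΓ C ϑ := rfl

/-- The mixed terms
`α ⊗ β ↦ ∑ αₖ ⊗ cₖ β - ∑ βₗ ⊗ α dₗ`, where `ϖ(α) = ∑ αₖ ⊗ cₖ` and `ϖ(β) = ∑ βₗ ⊗ dₗ`. -/
def mixed : C.inv ⊗[ℂ] C.inv →ₗ[ℂ] C.inv ⊗[ℂ] C.Envelope :=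
  (LinearMap.mul' ℂ C.Envelope).lTensor C.inv ∘ₗ
      (TensorProduct.assoc ℂ C.inv C.Envelope C.Envelope).toLinearMap ∘ₗ
      TensorProduct.map ((ofA C).toLinearMap.lTensor C.inv ∘ₗ C.varpi) C.ofInv -
    (LinearMap.mul' ℂ C.Envelope).lTensor C.inv ∘ₗ
      (TensorProduct.leftComm ℂ C.Envelope C.inv C.Envelope).toLinearMap ∘ₗ
      TensorProduct.map C.ofInv ((ofA C).toLinearMap.lTensor C.inv ∘ₗ C.varpi)

section

variable {Ω : Type*} [Ring Ω] [Algebra ℂ Ω] [StarAddMonoid Ω] [StarModule ℂ Ω]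
  (S : GDStarAlgebra Ω) (ω : C.inv →ₗ[ℂ] Ω)

/-- The map `ϑ ↦ ∑ ω(ϑₖ) ⊗ cₖ + 1 ⊗ ϑ`. -/
def connG : C.inv →ₗ[ℂ] C.GTensor S :=
  (C.toG S).toLinearMap ∘ₗ
    (TensorProduct.map ω (ofA C).toLinearMap ∘ₗ C.varpi + TensorProduct.mk ℂ _ _ 1 ∘ₗ C.ofInv)

variable {ω}

/-- The summands have degrees 0, 1 and 2 in the second tensor factor. The minus sign inside `mixed`
is the Koszul sign of moving the one-form `ω(βₗ)` past the one-form `α`. The algebra `Ω` is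
arbitrary so that the formula serves both for connections and for the inclusion of `Γ_inv` in `Γ^∧`.
-/
lemma connG_mul_connG (hω : ∀ ϑ, ω ϑ ∈ S.deg 1) (α β : C.inv) :
    C.connG S ω α * C.connG S ω β = C.toG S
      (TensorProduct.map (LinearMap.mul' ℂ Ω ∘ₗ TensorProduct.map ω ω) (ofA C).toLinearMap
        (C.varpi₂ (α ⊗ₜ β)) +
      TensorProduct.map ω LinearMap.id (C.mixed (α ⊗ₜ β)) + 1 ⊗ₜ (ofΓ C α * ofΓ C β)) := by
  have h11 (u v : C.inv ⊗[ℂ] A) : C.toG S (TensorProduct.map ω (ofA C).toLinearMap u) *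
      C.toG S (TensorProduct.map ω (ofA C).toLinearMap v) =
      C.toG S (TensorProduct.map (LinearMap.mul' ℂ Ω ∘ₗ TensorProduct.map ω ω) (ofA C).toLinearMap
        ((LinearMap.mul' ℂ A).lTensor (C.inv ⊗[ℂ] C.inv)
          (TensorProduct.tensorTensorTensorComm ℂ C.inv A C.inv A (u ⊗ₜ v)))) := by
    induction u with
    | zero => simp
    | add u u' h h' => simp only [map_add, add_mul, TensorProduct.add_tmul, h, h']
    | tmul x a =>
      induction v with
      | zero => simp
      | add v v' h h' => simp only [map_add, mul_add, TensorProduct.tmul_add, h, h']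
      | tmul y b => simp [toG_ofA_mul]
  have h12 (u : C.inv ⊗[ℂ] A) : C.toG S (TensorProduct.map ω (ofA C).toLinearMap u) *
      C.toG S (1 ⊗ₜ ofΓ C β) = C.toG S (TensorProduct.map ω LinearMap.id
        ((LinearMap.mul' ℂ C.Envelope).lTensor C.inv (TensorProduct.assoc ℂ _ _ _
          ((ofA C).toLinearMap.lTensor C.inv u ⊗ₜ ofΓ C β)))) := by
    induction u with
    | zero => simp
    | add u u' h h' => simp only [map_add, add_mul, TensorProduct.add_tmul, h, h']
    | tmul x a => simp [toG_ofA_mul]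
  have h21 (v : C.inv ⊗[ℂ] A) : C.toG S (1 ⊗ₜ ofΓ C α) *
      C.toG S (TensorProduct.map ω (ofA C).toLinearMap v) =
      -C.toG S (TensorProduct.map ω LinearMap.id
        ((LinearMap.mul' ℂ C.Envelope).lTensor C.inv (TensorProduct.leftComm ℂ _ _ _
          (ofΓ C α ⊗ₜ (ofA C).toLinearMap.lTensor C.inv v)))) := by
    induction v with
    | zero => simp
    | add u u' h h' => simp only [map_add, mul_add, TensorProduct.tmul_add, h, h', neg_add]
    | tmul x a => simp [toG_mul_deg_one _ _ _ _ (hω x)]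
  have h22 : C.toG S (1 ⊗ₜ ofΓ C α) * C.toG S (1 ⊗ₜ ofΓ C β) =
      C.toG S (1 ⊗ₜ (ofΓ C α * ofΓ C β)) := by
    rw [toG_mul_deg_zero _ _ _ _ SetLike.GradedOne.one_mem, one_mul]
  simp only [connG, mixed, varpi₂, LinearMap.comp_apply, LinearMap.add_apply, LinearMap.sub_apply,
    map_sub, map_add, LinearEquiv.coe_coe, TensorProduct.mk_apply, ofInv_apply,
    TensorProduct.map_tmul, mul_add, add_mul]
  rw [h11, h12, h21, h22]
  abel

lemma mul'_connG (hω : ∀ ϑ, ω ϑ ∈ S.deg 1) (z : C.inv ⊗[ℂ] C.inv) :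
    LinearMap.mul' ℂ _ (TensorProduct.map (C.connG S ω) (C.connG S ω) z) = C.toG S
      (TensorProduct.map (LinearMap.mul' ℂ Ω ∘ₗ TensorProduct.map ω ω) (ofA C).toLinearMap
        (C.varpi₂ z) + TensorProduct.map ω LinearMap.id (C.mixed z) +
        1 ⊗ₜ LinearMap.mul' ℂ C.Envelope (TensorProduct.map C.ofInv C.ofInv z)) := by
  induction z with
  | zero => simp
  | add x y hx hy => simp only [map_add, hx, hy, TensorProduct.tmul_add]; abel
  | tmul α β =>
    rw [TensorProduct.map_tmul, LinearMap.mul'_apply, C.connG_mul_connG S hω]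
    simp

/-- The middle term is negative because `d` on the second factor passes the one-forms `ω(ϑₖ)`. -/
lemma tensorD_connG (hω : ∀ ϑ, ω ϑ ∈ S.deg 1) (ϑ : C.inv) :
    S.tensorD (gdStar C) ((C.toG S).symm (C.connG S ω ϑ)) =
      TensorProduct.map (S.d ∘ₗ ω) (ofA C).toLinearMap (C.varpi ϑ) -
      TensorProduct.map ω (ofΓ C ∘ₗ C.d) (C.varpi ϑ) + 1 ⊗ₜ (gdStar C).d (ofΓ C ϑ) := by
  have h1 (u : C.inv ⊗[ℂ] A) : S.tensorD (gdStar C)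
      (TensorProduct.map ω (ofA C).toLinearMap u) =
      TensorProduct.map (S.d ∘ₗ ω) (ofA C).toLinearMap u -
      TensorProduct.map ω (ofΓ C ∘ₗ C.d) u := by
    induction u with
    | zero => simp
    | add u u' h h' => simp only [map_add, h, h']; abel
    | tmul x a =>
      have hd : (gdStar C).d (ofA C a) = ofΓ C (C.d a) := diff_ofA C a
      simp [GDStarAlgebra.tensorD, S.sgn_of_mem (hω x), hd, sub_eq_add_neg,
        TensorProduct.neg_tmul]
  have h2 : S.tensorD (gdStar C) ((1 : Ω) ⊗ₜ ofΓ C ϑ) = 1 ⊗ₜ (gdStar C).d (ofΓ C ϑ) := by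
    simp [GDStarAlgebra.tensorD, S.d_one, S.sgn_of_mem SetLike.GradedOne.one_mem]
  change S.tensorD _ (_ + _) = _
  rw [map_add, ← h2, ← h1]
  rfl

end

/-- Left invariance reduces the left action to `1 ⊗ ϑ`, and the right action restricts to `ϖ`. The
inclusion of `Γ_inv` thus transforms under the extended coproduct as a connection does under `F̂`.
-/
lemma comulHatΓ_inv (ϑ : C.inv) : C.comulHatΓ ϑ = C.connG (gdStar C) C.ofInv ϑ := by
  change C.toG _ (_ + _) = C.toG _ (_ + _)
  simp only [LinearMap.comp_apply]
  rw [C.mem_inv.1 ϑ.2, ← C.rTensor_varpi]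
  generalize C.varpi ϑ = u
  congr 2
  · induction u with
    | zero => simp
    | add u u' h h' => simp only [map_add, h, h']
    | tmul x a => simp
  · simp

/-- The component of bidegree `(1, 1)` of the identity obtained by applying the extended coproduct
to `d(ϑ) = ∑ ϑ¹ ϑ²`. -/
lemma mixed_of_lifts {ϑ : C.inv} {z : C.inv ⊗[ℂ] C.inv}
    (hz : LinearMap.mul' ℂ C.Envelope (TensorProduct.map C.ofInv C.ofInv z) =
      (gdStar C).d (ofΓ C ϑ)) :
    C.mixed z = -(ofΓ C ∘ₗ C.d).lTensor C.inv (C.varpi ϑ) := by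
  have hmul : ∀ w, C.comulHat (LinearMap.mul' ℂ C.Envelope (TensorProduct.map C.ofInv C.ofInv w)) =
      LinearMap.mul' ℂ _ (TensorProduct.map (C.connG (gdStar C) C.ofInv)
        (C.connG (gdStar C) C.ofInv) w) := by
    intro w
    induction w with
    | zero => simp
    | add x y hx hy => simp only [map_add, hx, hy]
    | tmul α β => simp [comulHat_ofΓ, comulHatΓ_inv]
  have hdeg : ∀ ϑ, C.ofInv ϑ ∈ (gdStar C).deg 1 := fun ϑ => ofΓ_mem C _
  have hd : (gdStar C).d (ofΓ C ϑ) = dΓ C ϑ := diff_ofΓ C _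
  have key := hmul z
  rw [hz, hd, comulHat_dΓ, C.mul'_connG (gdStar C) hdeg, hz, comulHatΓ_inv] at key
  have key' := congrArg (C.toG (gdStar C)).symm key
  change (gdStar C).tensorD (gdStar C) ((C.toG _).symm _) = _ at key'
  rw [C.tensorD_connG (gdStar C) hdeg, LinearEquiv.symm_apply_apply] at key'
  -- Applying `toΓ` to the left factor keeps only left degree one: the unit, the differentials
  -- `d(ϑₖ)` and the products of two one-forms are annihilated.
  have key2 := congrArg ((toΓ C).rTensor C.Envelope) key'
  have e1 (t : C.inv ⊗[ℂ] A) : (toΓ C).rTensor C.Envelope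
      (TensorProduct.map ((gdStar C).d ∘ₗ C.ofInv) (ofA C).toLinearMap t) = 0 := by
    induction t with
    | zero => simp
    | add x y hx hy => rw [map_add, map_add, hx, hy, add_zero]
    | tmul x a =>
      have hd : (gdStar C).d (ofΓ C x) = dΓ C x := diff_ofΓ C _
      simp [hd]
  have e2 (t : C.inv ⊗[ℂ] A) : (toΓ C).rTensor C.Envelope
      (TensorProduct.map C.ofInv (ofΓ C ∘ₗ C.d) t) =
      C.inv.subtype.rTensor _ ((ofΓ C ∘ₗ C.d).lTensor C.inv t) := by
    induction t with
    | zero => simp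
    | add x y hx hy => simp only [map_add, hx, hy]
    | tmul x a => simp
  have e3 (t : (C.inv ⊗[ℂ] C.inv) ⊗[ℂ] A) : (toΓ C).rTensor C.Envelope
      (TensorProduct.map (LinearMap.mul' ℂ C.Envelope ∘ₗ TensorProduct.map C.ofInv C.ofInv)
        (ofA C).toLinearMap t) = 0 := by
    induction t with
    | zero => simp
    | add x y hx hy => rw [map_add, map_add, hx, hy, add_zero]
    | tmul x a =>
      induction x with
      | zero => simp
      | add x y hx hy => rw [TensorProduct.add_tmul, map_add, map_add, hx, hy, add_zero]
      | tmul x y => simp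
  have e4 (t : C.inv ⊗[ℂ] C.Envelope) : (toΓ C).rTensor C.Envelope
      (TensorProduct.map C.ofInv LinearMap.id t) = C.inv.subtype.rTensor _ t := by
    induction t with
    | zero => simp
    | add x y hx hy => simp only [map_add, hx, hy]
    | tmul x a => simp
  have e5 (t : C.Envelope) : (toΓ C).rTensor C.Envelope ((1 : C.Envelope) ⊗ₜ t) = 0 := by
    rw [LinearMap.rTensor_tmul, ← map_one (ofA C), toΓ_ofA, TensorProduct.zero_tmul]
  rw [map_add, map_sub, map_add, map_add, e1, e2, e3, e4, e5, add_zero, add_zero, zero_add,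
    zero_sub, ← map_neg] at key2
  -- The equality now holds in `Γ ⊗ Γ^∧`; it descends to `Γ_inv ⊗ Γ^∧` because tensoring over a
  -- field preserves injectivity.
  exact (Module.Flat.rTensor_preserves_injective_linearMap C.inv.subtype
    C.inv.injective_subtype key2).symm

end BicovariantCalculus

/-! ### Tensoriality of the curvature -/

namespace BundleCalculus

open BicovariantCalculus BicovariantCalculus.Envelope

variable {A Γ V B Ω : Type*} [Ring A] [HopfAlgebra ℂ A] [StarRing A]
    [StarModule ℂ A] [AddCommGroup Γ] [Module ℂ Γ] [Module A Γ] [Module Aᵐᵒᵖ Γ]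
    [IsScalarTower ℂ A Γ] [IsScalarTower ℂ Aᵐᵒᵖ Γ] [SMulCommClass A Aᵐᵒᵖ Γ]
    [StarAddMonoid Γ] [StarModule ℂ Γ]
    [Ring V] [Algebra ℂ V] [StarRing V] [StarModule ℂ V]
    [Ring B] [Algebra ℂ B] [StarRing B] [StarModule ℂ B]
    {C : BicovariantCalculus A Γ} {P : QuantumPrincipalBundle A V B}
    [Ring Ω] [Algebra ℂ Ω] [StarAddMonoid Ω] [StarModule ℂ Ω] (X : BundleCalculus C P Ω)

/-- A linear map `φ : Γ_inv → Ω(P)` is tensorial if `F̂ φ = (φ ⊗ id) ϖ`. -/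
def IsTensorial (φ : C.inv →ₗ[ℂ] Ω) : Prop :=
  ∀ ϑ, X.hatF (φ ϑ) = TensorProduct.map φ (ofA C).toLinearMap (C.varpi ϑ)

variable {X}

lemma toG_hatF (x : Ω) : C.toG X.gd (X.hatF x) = X.action x := rfl

lemma IsTensorial.wedgeF {φ : C.inv →ₗ[ℂ] Ω} (h : X.IsTensorial φ) (ϑ : C.inv) :
    X.wedgeF (φ ϑ) = φ.rTensor A (C.varpi ϑ) := by
  rw [BundleCalculus.wedgeF, LinearMap.comp_apply, h ϑ]
  generalize C.varpi ϑ = u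
  induction u with
  | zero => simp
  | add x y hx hy => simp only [map_add, hx, hy]
  | tmul x a => simp [proj]

variable [HopfStarAlgebra A] {ω : C.inv →ₗ[ℂ] Ω}

lemma IsConnection.action (h : X.IsConnection ω) (ϑ : C.inv) :
    X.action (ω ϑ) = C.connG X.gd ω ϑ := by
  rw [← toG_hatF, h.hatF]; rfl

/-- The inhomogeneous term `1 ⊗ ϑ` has positive degree in `Γ^∧` and is killed by `p_*`. A connection
is therefore an admissible `φ` in the definition of its own ideal `𝒦_ω`. -/
lemma IsConnection.isPseudotensorial (h : X.IsConnection ω) : X.IsPseudotensorial 1 ω where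
  deg_mem := h.deg_one
  wedgeF ϑ := by
    rw [BundleCalculus.wedgeF, LinearMap.comp_apply, h.hatF, map_add]
    have h0 : (proj C).toLinearMap.lTensor Ω ((1 : Ω) ⊗ₜ ofΓ C ϑ) = 0 := by simp [proj]
    rw [h0, add_zero]
    generalize C.varpi ϑ = u
    induction u with
    | zero => simp
    | add x y hx hy => simp only [map_add, hx, hy]
    | tmul x a => simp [proj]

lemma IsConnection.isTensorial_sub (h : X.IsConnection ω) {τ : C.inv →ₗ[ℂ] Ω}
    (h' : X.IsConnection τ) : X.IsTensorial (τ - ω) := by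
  intro ϑ
  rw [LinearMap.sub_apply, map_sub, h.hatF, h'.hatF, map_sub_left,
    LinearMap.sub_apply, add_sub_add_right_eq_sub]

lemma curvature_mem_deg (δ : EmbeddedDifferential C) (h : X.IsConnection ω) (ϑ : C.inv) :
    X.curvature δ ω ϑ ∈ X.gd.deg 2 := by
  refine sub_mem (X.gd.d_mem 1 _ (h.deg_one ϑ)) ?_
  simp only [bracket, LinearMap.comp_apply]
  generalize δ.δ ϑ = z
  induction z with
  | zero => simp
  | add x y hx hy => simp only [map_add]; exact add_mem hx hy
  | tmul α β => exact SetLike.mul_mem_graded (h.deg_one α) (h.deg_one β)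

/-- Both `F̂ dω(ϑ)` and `F̂⟨ω, ω⟩(ϑ)` contain `1 ⊗ dϑ` and, by `mixed_of_lifts`, the same mixed term
`-∑ ω(ϑₖ) ⊗ d(cₖ)`. These cancel, and equivariance of `δ` brings the remaining quadratic term to the
form `∑ ⟨ω, ω⟩(ϑₖ) ⊗ cₖ`. -/
lemma curvature_isTensorial (δ : EmbeddedDifferential C) (h : X.IsConnection ω) :
    X.IsTensorial (X.curvature δ ω) := by
  intro ϑ
  have hmul : ∀ z, X.action (LinearMap.mul' ℂ Ω (TensorProduct.map ω ω z)) =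
      LinearMap.mul' ℂ _ (TensorProduct.map (C.connG X.gd ω) (C.connG X.gd ω) z) := by
    intro z
    induction z with
    | zero => simp
    | add x y hx hy => simp only [map_add, hx, hy]
    | tmul α β => simp [h.action]
  have hl : LinearMap.mul' ℂ C.Envelope (TensorProduct.map C.ofInv C.ofInv (δ.δ ϑ)) =
      (gdStar C).d (ofΓ C ϑ) := δ.lifts ϑ
  have hb : X.hatF (bracket δ ω ω ϑ) = _ := congrArg (C.toG X.gd).symm (hmul (δ.δ ϑ))
  rw [C.mul'_connG X.gd h.deg_one, LinearEquiv.symm_apply_apply, hl, C.mixed_of_lifts hl,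
    ← δ.intertwines] at hb
  have hd : X.hatF (X.gd.d (ω ϑ)) = _ := X.action_d (ω ϑ)
  rw [h.action, C.tensorD_connG X.gd h.deg_one] at hd
  rw [curvature, LinearMap.sub_apply, map_sub, LinearMap.comp_apply, hd, hb]
  generalize C.varpi ϑ = u
  have e1 : TensorProduct.map ω LinearMap.id (-(ofΓ C ∘ₗ C.d).lTensor C.inv u) =
      -TensorProduct.map ω (ofΓ C ∘ₗ C.d) u := by
    rw [map_neg, LinearMap.lTensor, ← LinearMap.comp_apply, ← TensorProduct.map_comp]; rfl
  have e2 : TensorProduct.map (LinearMap.mul' ℂ Ω ∘ₗ TensorProduct.map ω ω) (ofA C).toLinearMap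
      (δ.δ.rTensor A u) = TensorProduct.map (bracket δ ω ω) (ofA C).toLinearMap u := by
    rw [LinearMap.rTensor, ← LinearMap.comp_apply, ← TensorProduct.map_comp]; rfl
  rw [e1, e2, map_sub_left, LinearMap.sub_apply]
  abel

end BundleCalculus

end

end QuantumBundle

namespace QuantumBundle

set_option linter.unusedSectionVars false

noncomputable section

lemma GDStarAlgebra.sgn_mul {R : Type*} [Ring R] [Algebra ℂ R]
    [StarAddMonoid R] [StarModule ℂ R] (S : GDStarAlgebra R) (x y : R) :
    S.sgn (x * y) = S.sgn x * S.sgn y := by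
  induction x using graded_induction S.deg with
  | hadd x x' h h' => simp only [map_add, add_mul, h, h']
  | h p x hx =>
    induction y using graded_induction S.deg with
    | hadd x x' h h' => simp only [map_add, mul_add, h, h']
    | h q y hy =>
      rw [S.sgn_of_mem hx, S.sgn_of_mem hy, S.sgn_of_mem (SetLike.mul_mem_graded hx hy),
        smul_mul_smul_comm, pow_add]

/-! ### Derivations of the tensor algebra along a homomorphism -/

section Variation

variable {M R S : Type*} [AddCommGroup M] [Module ℂ M] [Ring R] [Algebra ℂ R] [Ring S] [Algebra ℂ S]

/-- The algebra homomorphism `x ↦ (f^⊗(x), D(x))`, where `D` is the derivation along `f^⊗` extending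
`g`. -/
def variationHom (f g : M →ₗ[ℂ] R) : TensorAlgebra ℂ M →ₐ[ℂ] TrivSqZeroExt R R :=
  TensorAlgebra.lift ℂ ((TrivSqZeroExt.inlAlgHom ℂ R R).toLinearMap ∘ₗ f +
    ((TrivSqZeroExt.inrHom R R).restrictScalars ℂ) ∘ₗ g)

/-- The derivation along the multiplicative extension of `f` which extends `g`:
`ϑ₁ ⊗ ⋯ ⊗ ϑₙ ↦ ∑ f(ϑ₁) ⋯ g(ϑᵢ) ⋯ f(ϑₙ)`. -/
def variation (f g : M →ₗ[ℂ] R) : TensorAlgebra ℂ M →ₗ[ℂ] R :=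
  ((TrivSqZeroExt.sndHom R R).restrictScalars ℂ) ∘ₗ (variationHom f g).toLinearMap

lemma fst_variationHom (f g : M →ₗ[ℂ] R) (x : TensorAlgebra ℂ M) :
    (variationHom f g x).fst = TensorAlgebra.lift ℂ f x := by
  have h : (TrivSqZeroExt.fstHom ℂ R R).comp (variationHom f g) = TensorAlgebra.lift ℂ f := by
    ext m
    simp [variationHom]
  exact DFunLike.congr_fun h x

@[simp] lemma variation_ι (f g : M →ₗ[ℂ] R) (m : M) :
    variation f g (TensorAlgebra.ι ℂ m) = g m := by
  simp [variation, variationHom]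

@[simp] lemma variation_algebraMap (f g : M →ₗ[ℂ] R) (r : ℂ) :
    variation f g (algebraMap ℂ _ r) = 0 := by
  simp only [variation, LinearMap.comp_apply, AlgHom.toLinearMap_apply, AlgHom.commutes]
  rfl

lemma variation_mul (f g : M →ₗ[ℂ] R) (x y : TensorAlgebra ℂ M) :
    variation f g (x * y) = TensorAlgebra.lift ℂ f x * variation f g y +
      variation f g x * TensorAlgebra.lift ℂ f y := by
  simp only [← fst_variationHom f g, variation, LinearMap.comp_apply, AlgHom.toLinearMap_apply,
    map_mul]
  exact TrivSqZeroExt.snd_mul _ _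

lemma map_lift_eq (e : R →ₐ[ℂ] S) (f : M →ₗ[ℂ] R) (x : TensorAlgebra ℂ M) :
    e (TensorAlgebra.lift ℂ f x) = TensorAlgebra.lift ℂ (e.toLinearMap ∘ₗ f) x := by
  have h : e.comp (TensorAlgebra.lift ℂ f) = TensorAlgebra.lift ℂ (e.toLinearMap ∘ₗ f) := by
    ext m
    simp
  exact DFunLike.congr_fun h x

lemma map_variation (e : R →ₐ[ℂ] S) (f g : M →ₗ[ℂ] R) (x : TensorAlgebra ℂ M) :
    e (variation f g x) = variation (e.toLinearMap ∘ₗ f) (e.toLinearMap ∘ₗ g) x := by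
  induction x using TensorAlgebra.induction with
  | algebraMap r => simp
  | ι m => simp
  | add x y hx hy => simp only [map_add, hx, hy]
  | mul x y hx hy => simp only [variation_mul, map_add, map_mul, hx, hy, map_lift_eq]

end Variation

/-! ### Polynomials over a noncommutative algebra at scalar points -/

section PolynomialValues

open Polynomial

variable {R : Type*} [Ring R] [Algebra ℂ R]

/-- Evaluation of polynomials at a scalar. -/
def evalScalar (z : ℂ) : R[X] →ₐ[ℂ] R :=
  -- Evaluation is multiplicative although `R` need not be commutative, because the point of
  -- evaluation is central.
  { eval₂RingHom' (RingHom.id R) (algebraMap ℂ R z)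
      (fun a => (Algebra.commutes z a).symm) with
    commutes' := fun _ => eval₂_C _ _ }

@[simp] lemma evalScalar_monomial (z : ℂ) (n : ℕ) (a : R) :
    evalScalar z (monomial n a) = z ^ n • a := by
  change eval₂ _ _ _ = _
  rw [eval₂_monomial, ← map_pow, Algebra.smul_def, Algebra.commutes]
  rfl

@[simp] lemma evalScalar_C (z : ℂ) (a : R) : evalScalar z (C a) = a := by
  rw [← monomial_zero_left, evalScalar_monomial, pow_zero, one_smul]

lemma evalScalar_eq_sum (z : ℂ) (p : R[X]) :
    evalScalar z p = ∑ n ∈ p.support, z ^ n • p.coeff n := by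
  conv_lhs => rw [p.as_sum_support]
  simp

/-- A polynomial with values in a subspace at all real points has all coefficients in it. -/
lemma coeff_mem_of_evalScalar_mem (S : Submodule ℂ R) (p : R[X])
    (h : ∀ t : ℝ, evalScalar (t : ℂ) p ∈ S) (n : ℕ) : p.coeff n ∈ S := by
  by_contra hn
  -- A functional that vanishes on `S` but not on the coefficient reduces the claim to a complex
  -- polynomial with infinitely many zeros.
  obtain ⟨f, hf, hS⟩ := Submodule.exists_le_ker_of_notMem hn
  let q : ℂ[X] := ∑ k ∈ p.support, monomial k (f (p.coeff k))
  have hq : q = 0 := by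
    refine eq_of_infinite_eval_eq q 0
      ((Set.infinite_range_of_injective Complex.ofReal_injective).mono ?_)
    rintro _ ⟨t, rfl⟩
    have h0 : f (evalScalar (t : ℂ) p) = 0 := hS (h t)
    rw [evalScalar_eq_sum, map_sum] at h0
    simp only [map_smul, smul_eq_mul] at h0
    simp only [Set.mem_ofPred_eq, q, eval_finsetSum, eval_monomial, eval_zero]
    rw [← h0]
    exact Finset.sum_congr rfl fun k _ => mul_comm _ _
  apply hf
  have hc := congrArg (fun q : ℂ[X] => q.coeff n) hq
  simp only [q, finsetSum_coeff, coeff_monomial, coeff_zero, Finset.sum_ite_eq', mem_support_iff]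
    at hc
  by_cases h0 : p.coeff n = 0
  · rw [h0, map_zero]
  · simpa [h0] using hc

end PolynomialValues

namespace BundleCalculus

open BicovariantCalculus BicovariantCalculus.Envelope

variable {A Γ V B Ω : Type*} [Ring A] [HopfAlgebra ℂ A] [StarRing A]
    [StarModule ℂ A] [AddCommGroup Γ] [Module ℂ Γ] [Module A Γ] [Module Aᵐᵒᵖ Γ]
    [IsScalarTower ℂ A Γ] [IsScalarTower ℂ Aᵐᵒᵖ Γ] [SMulCommClass A Aᵐᵒᵖ Γ]
    [StarAddMonoid Γ] [StarModule ℂ Γ]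
    [Ring V] [Algebra ℂ V] [StarRing V] [StarModule ℂ V]
    [Ring B] [Algebra ℂ B] [StarRing B] [StarModule ℂ B]
    {C : BicovariantCalculus A Γ} {P : QuantumPrincipalBundle A V B}
    [Ring Ω] [Algebra ℂ Ω] [StarAddMonoid Ω] [StarModule ℂ Ω] {X : BundleCalculus C P Ω}

/-! ### From invariant tensors to forms on the base -/

section Tensorial

variable {ρ : C.inv →ₗ[ℂ] Ω}

/-- Tensoriality propagates through products because the second tensor factors stay in degree zero,
where no Koszul signs arise. -/
lemma IsTensorial.action_lift (hρ : X.IsTensorial ρ) (x : TensorAlgebra ℂ C.inv) :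
    X.action (TensorAlgebra.lift ℂ ρ x) = C.toG X.gd (TensorProduct.map
      (TensorAlgebra.lift ℂ ρ).toLinearMap (ofA C).toLinearMap (C.varpiT x)) := by
  induction x using TensorAlgebra.induction with
  | algebraMap r =>
    simp only [Algebra.algebraMap_eq_smul_one, map_smul, map_one,
      Algebra.TensorProduct.one_def, TensorProduct.map_tmul, AlgHom.toLinearMap_apply]
    rfl
  | ι m =>
    rw [TensorAlgebra.lift_ι_apply, ← toG_hatF, hρ, varpiT, TensorAlgebra.lift_ι_apply,
      LinearMap.comp_apply]
    generalize C.varpi m = u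
    induction u with
    | zero => simp
    | add x y hx hy => simp only [map_add, hx, hy]
    | tmul x a => simp
  | add x y hx hy => simp only [map_add, hx, hy]
  | mul x y hx hy =>
    simp only [map_mul, hx, hy]
    generalize C.varpiT x = u
    generalize C.varpiT y = v
    induction u with
    | zero => simp
    | add u u' h h' => simp only [map_add, add_mul, h, h']
    | tmul x a =>
      induction v with
      | zero => simp
      | add v v' h h' => simp only [map_add, mul_add, h, h']
      | tmul y b => simp [toG_ofA_mul]

lemma IsTensorial.action_variation (hρ : X.IsTensorial ρ) {φ : C.inv →ₗ[ℂ] Ω}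
    (hφ : X.IsTensorial φ) (x : TensorAlgebra ℂ C.inv) :
    X.action (variation ρ φ x) = C.toG X.gd (TensorProduct.map
      (variation ρ φ) (ofA C).toLinearMap (C.varpiT x)) := by
  induction x using TensorAlgebra.induction with
  | algebraMap r =>
    rw [AlgHom.commutes, Algebra.TensorProduct.algebraMap_apply, TensorProduct.map_tmul]
    simp
  | ι m =>
    rw [variation_ι, ← toG_hatF, hφ, varpiT, TensorAlgebra.lift_ι_apply,
      LinearMap.comp_apply]
    generalize C.varpi m = u
    induction u with
    | zero => simp
    | add x y hx hy => simp only [map_add, hx, hy]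
    | tmul x a => simp
  | add x y hx hy => simp only [map_add, hx, hy]
  | mul x y hx hy =>
    simp only [variation_mul, map_mul, map_add, hx, hy, hρ.action_lift]
    generalize C.varpiT x = u
    generalize C.varpiT y = v
    induction u with
    | zero => simp
    | add u u' h h' => simp only [map_add, add_mul, ← h, ← h']; abel
    | tmul x a =>
      induction v with
      | zero => simp
      | add v v' h h' => simp only [map_add, mul_add, ← h, ← h']; abel
      | tmul y b => simp [toG_ofA_mul, variation_mul, TensorProduct.add_tmul]

lemma mem_baseForms_of_action {f : TensorAlgebra ℂ C.inv →ₗ[ℂ] Ω} {x : TensorAlgebra ℂ C.inv}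
    (hx : x ∈ C.invariants) (h : X.action (f x) = C.toG X.gd (TensorProduct.map
      f (ofA C).toLinearMap (C.varpiT x))) : f x ∈ X.baseForms := by
  have hv : C.varpiT x = x ⊗ₜ 1 := hx
  rw [hv, TensorProduct.map_tmul, AlgHom.toLinearMap_apply, map_one] at h
  exact h

lemma baseForms_le_hor {x : Ω} (hx : x ∈ X.baseForms) : x ∈ X.hor :=
  ⟨x ⊗ₜ 1, by rw [X.mem_baseForms.1 hx]; simp⟩

end Tensorial

variable [HopfStarAlgebra A] {δ : EmbeddedDifferential C} {ω φ : C.inv →ₗ[ℂ] Ω}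

/-! ### The Bianchi identity modulo `𝒦_ω` and closedness of `W^ω` -/

section Ideal

lemma smul_mem_idealK (z : ℂ) {x : Ω} (hx : x ∈ X.idealK δ ω) : z • x ∈ X.idealK δ ω := by
  rw [Algebra.smul_def]
  exact TwoSidedIdeal.mul_mem_left _ _ _ hx

lemma bracket_mem_left {f g : C.inv →ₗ[ℂ] Ω} (hf : ∀ ϑ, f ϑ ∈ X.idealK δ ω) (ϑ : C.inv) :
    bracket δ f g ϑ ∈ X.idealK δ ω := by
  simp only [bracket, LinearMap.comp_apply]
  generalize δ.δ ϑ = z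
  induction z with
  | zero => simp
  | add x y hx hy => rw [map_add, map_add]; exact TwoSidedIdeal.add_mem _ hx hy
  | tmul α β => exact TwoSidedIdeal.mul_mem_right _ _ _ (hf α)

lemma bracket_mem_right {f g : C.inv →ₗ[ℂ] Ω} (hg : ∀ ϑ, g ϑ ∈ X.idealK δ ω) (ϑ : C.inv) :
    bracket δ f g ϑ ∈ X.idealK δ ω := by
  simp only [bracket, LinearMap.comp_apply]
  generalize δ.δ ϑ = z
  induction z with
  | zero => simp
  | add x y hx hy => rw [map_add, map_add]; exact TwoSidedIdeal.add_mem _ hx hy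
  | tmul α β => exact TwoSidedIdeal.mul_mem_left _ _ _ (hg β)

lemma IsPseudotensorial.sub_mem {n : ℕ} (h : X.IsPseudotensorial n φ) (ϑ : C.inv) :
    bracket δ ω φ ϑ - (-1 : ℂ) ^ n • bracket δ φ ω ϑ ∈ X.idealK δ ω :=
  TwoSidedIdeal.subset_span ⟨n, φ, ϑ, h, rfl⟩

/-- With `φ = ω`, of odd degree one, the generator of `𝒦_ω` is `2⟨ω, ω⟩(ϑ)`. -/
lemma IsConnection.bracket_self_mem (h : X.IsConnection ω) (ϑ : C.inv) :
    bracket δ ω ω ϑ ∈ X.idealK δ ω := by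
  have h1 := smul_mem_idealK (2⁻¹ : ℂ) (h.isPseudotensorial.sub_mem (δ := δ) (ω := ω) ϑ)
  rw [pow_one, neg_one_smul, sub_neg_eq_add, ← two_smul ℂ, smul_smul] at h1
  simpa using h1

lemma d_bracket_self (hω : ∀ ϑ, ω ϑ ∈ X.gd.deg 1) (ϑ : C.inv) :
    X.gd.d (bracket δ ω ω ϑ) = bracket δ (X.gd.d ∘ₗ ω) ω ϑ - bracket δ ω (X.gd.d ∘ₗ ω) ϑ := by
  simp only [bracket, LinearMap.comp_apply]
  generalize δ.δ ϑ = z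
  induction z with
  | zero => simp
  | add x y hx hy => simp only [map_add, hx, hy]; abel
  | tmul α β =>
    simp only [TensorProduct.map_tmul, LinearMap.mul'_apply, LinearMap.comp_apply,
      X.gd.leibniz 1 _ (hω α)]
    simp [sub_eq_add_neg]

lemma bracket_add_left (f g h : C.inv →ₗ[ℂ] Ω) :
    bracket δ (f + g) h = bracket δ f h + bracket δ g h := by
  rw [bracket, TensorProduct.map_add_left, LinearMap.add_comp, LinearMap.comp_add]; rfl

lemma bracket_add_right (f g h : C.inv →ₗ[ℂ] Ω) :
    bracket δ h (f + g) = bracket δ h f + bracket δ h g := by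
  rw [bracket, TensorProduct.map_add_right, LinearMap.add_comp, LinearMap.comp_add]; rfl

lemma bracket_smul_left (z : ℂ) (f h : C.inv →ₗ[ℂ] Ω) :
    bracket δ (z • f) h = z • bracket δ f h := by
  rw [bracket, TensorProduct.map_smul_left, LinearMap.smul_comp, LinearMap.comp_smul]; rfl

lemma bracket_smul_right (z : ℂ) (f h : C.inv →ₗ[ℂ] Ω) :
    bracket δ h (z • f) = z • bracket δ h f := by
  rw [bracket, TensorProduct.map_smul_right, LinearMap.smul_comp, LinearMap.comp_smul]; rfl

lemma IsConnection.curvature_isPseudotensorial (h : X.IsConnection ω) :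
    X.IsPseudotensorial 2 (X.curvature δ ω) where
  deg_mem := curvature_mem_deg δ h
  wedgeF := (curvature_isTensorial δ h).wedgeF

/-- The Bianchi identity, modulo the ideal `𝒦_ω`. -/
lemma IsConnection.d_curvature_mem (h : X.IsConnection ω) (ϑ : C.inv) :
    X.gd.d (X.curvature δ ω ϑ) ∈ X.idealK δ ω := by
  have hd : X.gd.d ∘ₗ ω = X.curvature δ ω + bracket δ ω ω := by simp [curvature]
  -- Substituting `dω = R_ω + ⟨ω, ω⟩` in `-d⟨ω, ω⟩` leaves a generator for `φ = R_ω`, of degree two,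
  -- and cubic terms. The cubic terms need no associativity-type identity for `δ`, since each
  -- contains the factor `⟨ω, ω⟩`.
  have e : X.gd.d (X.curvature δ ω ϑ) =
      (bracket δ ω (X.curvature δ ω) ϑ - (-1 : ℂ) ^ 2 • bracket δ (X.curvature δ ω) ω ϑ) +
      (bracket δ ω (bracket δ ω ω) ϑ - bracket δ (bracket δ ω ω) ω ϑ) := by
    conv_lhs => rw [curvature, LinearMap.sub_apply, map_sub, LinearMap.comp_apply, X.gd.d_d,
      d_bracket_self h.deg_one, hd, bracket_add_left, bracket_add_right]
    simp only [LinearMap.add_apply, neg_one_sq, one_smul]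
    abel
  rw [e]
  exact TwoSidedIdeal.add_mem _ (h.curvature_isPseudotensorial.sub_mem ϑ)
    (TwoSidedIdeal.sub_mem _ (bracket_mem_right h.bracket_self_mem ϑ)
      (bracket_mem_left h.bracket_self_mem ϑ))

/-- Products of two-forms are even. This removes the signs both from the Leibniz rule and from the
involution. -/
lemma IsConnection.sgn_weilForm (h : X.IsConnection ω) (x : TensorAlgebra ℂ C.inv) :
    X.gd.sgn (X.weilForm δ ω x) = X.weilForm δ ω x := by
  induction x using TensorAlgebra.induction with
  | algebraMap r =>
    rw [AlgHom.commutes, Algebra.algebraMap_eq_smul_one, map_smul,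
      X.gd.sgn_of_mem SetLike.GradedOne.one_mem, pow_zero, one_smul]
  | ι m =>
    rw [weilForm, TensorAlgebra.lift_ι_apply, X.gd.sgn_of_mem (curvature_mem_deg δ h m),
      neg_one_sq, one_smul]
  | add x y hx hy => simp only [map_add, hx, hy]
  | mul x y hx hy => rw [map_mul, X.gd.sgn_mul, hx, hy]

lemma IsConnection.d_weilForm_mem (h : X.IsConnection ω) (x : TensorAlgebra ℂ C.inv) :
    X.gd.d (X.weilForm δ ω x) ∈ X.idealK δ ω := by
  induction x using TensorAlgebra.induction with
  | algebraMap r =>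
    rw [AlgHom.commutes, Algebra.algebraMap_eq_smul_one, map_smul, X.gd.d_one, smul_zero]
    exact TwoSidedIdeal.zero_mem _
  | ι m =>
    rw [weilForm, TensorAlgebra.lift_ι_apply]
    exact h.d_curvature_mem m
  | add x y hx hy => rw [map_add, map_add]; exact TwoSidedIdeal.add_mem _ hx hy
  | mul x y hx hy =>
    rw [map_mul, X.gd.d_mul]
    exact TwoSidedIdeal.add_mem _ (TwoSidedIdeal.mul_mem_right _ _ _ hx)
      (TwoSidedIdeal.mul_mem_left _ _ _ hy)

lemma IsConnection.weilForm_mem_baseForms (h : X.IsConnection ω) {x : TensorAlgebra ℂ C.inv}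
    (hx : x ∈ C.invariants) : X.weilForm δ ω x ∈ X.baseForms :=
  mem_baseForms_of_action (f := (X.weilForm δ ω).toLinearMap) hx
    ((curvature_isTensorial δ h).action_lift x)

/-- Invariance makes the differential a form on the base, hence horizontal, while the Bianchi
identity puts it in `𝒦_ω`; the splitting condition leaves only zero. -/
lemma IsConnection.d_weilForm (h : X.IsConnection ω) (hs : X.Splitting δ ω)
    {x : TensorAlgebra ℂ C.inv} (hx : x ∈ C.invariants) : X.gd.d (X.weilForm δ ω x) = 0 :=
  hs _ (baseForms_le_hor (X.d_mem_baseForms (h.weilForm_mem_baseForms hx))) (h.d_weilForm_mem x)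

end Ideal

/-! ### Transgression along a line of connections -/

section Transgression

open Polynomial

variable (X δ ω φ) in
/-- The curvature of the connections `ω + t φ`, as a polynomial in `t`. -/
def curvaturePoly : C.inv →ₗ[ℂ] Polynomial Ω :=
  (monomial 0).restrictScalars ℂ ∘ₗ X.curvature δ ω +
    (monomial 1).restrictScalars ℂ ∘ₗ (X.gd.d ∘ₗ φ - bracket δ ω φ - bracket δ φ ω) -
    (monomial 2).restrictScalars ℂ ∘ₗ bracket δ φ φ

lemma evalScalar_curvaturePoly (z : ℂ) :
    (evalScalar z).toLinearMap ∘ₗ X.curvaturePoly δ ω φ = X.curvature δ (ω + z • φ) := by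
  ext ϑ
  simp only [curvaturePoly, curvature, LinearMap.comp_apply, LinearMap.add_apply,
    LinearMap.sub_apply, AlgHom.toLinearMap_apply, map_add, map_sub, LinearMap.restrictScalars_apply,
    evalScalar_monomial, bracket_add_left, bracket_add_right, bracket_smul_left, bracket_smul_right,
    LinearMap.smul_apply, map_smul, smul_add, smul_smul, pow_zero, pow_one, one_smul, sq]
  abel

/-- The derivative `2z⟨φ, φ⟩` of the quadratic term is shared equally between the two brackets,
which replaces `ω` by `ω + zφ` in each of them. -/
lemma evalScalar_derivative_curvaturePoly (z : ℂ) (ϑ : C.inv) :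
    evalScalar z (derivative (X.curvaturePoly δ ω φ ϑ)) =
      X.gd.d (φ ϑ) - (bracket δ (ω + z • φ) φ ϑ + bracket δ φ (ω + z • φ) ϑ) := by
  simp only [curvaturePoly, LinearMap.comp_apply, LinearMap.add_apply,
    LinearMap.sub_apply, map_add, map_sub, LinearMap.restrictScalars_apply, derivative_monomial,
    evalScalar_monomial, bracket_add_left, bracket_add_right, bracket_smul_left, bracket_smul_right,
    LinearMap.smul_apply]
  simp [mul_two]
  abel

/-- The difference between the derivative of `W^{ω + t φ}` and the differential of the
transgression form belongs to the ideal `𝒦`. -/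
lemma derivative_sub_mem (z : ℂ) (h : X.IsConnection (ω + z • φ)) (hφ : X.IsPseudotensorial 1 φ)
    (x : TensorAlgebra ℂ C.inv) :
    evalScalar z (derivative (TensorAlgebra.lift ℂ (X.curvaturePoly δ ω φ) x)) -
      X.gd.d (variation (X.curvature δ (ω + z • φ)) φ x) ∈ X.idealK δ (ω + z • φ) := by
  induction x using TensorAlgebra.induction with
  | algebraMap r =>
    rw [AlgHom.commutes, variation_algebraMap, map_zero, sub_zero, Polynomial.algebraMap_apply,
      derivative_C, map_zero]
    exact TwoSidedIdeal.zero_mem _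
  | ι m =>
    rw [TensorAlgebra.lift_ι_apply, variation_ι, evalScalar_derivative_curvaturePoly,
      sub_sub_cancel_left]
    -- Since `φ` has degree one, the generator is the symmetric sum of the two brackets.
    have h1 := TwoSidedIdeal.neg_mem _ (hφ.sub_mem (δ := δ) (ω := ω + z • φ) m)
    simpa using h1
  | add x y hx hy =>
    have h1 := TwoSidedIdeal.add_mem _ hx hy
    rw [← add_sub_add_comm] at h1
    simpa only [map_add] using h1
  | mul x y hx hy =>
    have e (x) : evalScalar z (TensorAlgebra.lift ℂ (X.curvaturePoly δ ω φ) x) =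
        X.weilForm δ (ω + z • φ) x := by
      rw [map_lift_eq, evalScalar_curvaturePoly]; rfl
    have e' (x) : TensorAlgebra.lift ℂ (X.curvature δ (ω + z • φ)) x =
        X.weilForm δ (ω + z • φ) x := rfl
    rw [map_mul, derivative_mul, variation_mul, map_add, map_add, map_mul, map_mul, e, e, e', e',
      X.gd.d_mul, X.gd.d_mul, h.sgn_weilForm]
    -- The differential of the variation also produces the terms `dW(x) · var(y)` and `± var(x) ·
    -- dW(y)`; both lie in the ideal because `dW` does.
    have key := TwoSidedIdeal.sub_mem _ (TwoSidedIdeal.add_mem _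
      (TwoSidedIdeal.mul_mem_right _ _ (X.weilForm δ (ω + z • φ) y) hx)
      (TwoSidedIdeal.mul_mem_left _ (X.weilForm δ (ω + z • φ) x) _ hy))
      (TwoSidedIdeal.add_mem _ (TwoSidedIdeal.mul_mem_right _ _
          (variation (X.curvature δ (ω + z • φ)) φ y) (h.d_weilForm_mem (δ := δ) x))
        (TwoSidedIdeal.mul_mem_left _ (X.gd.sgn (variation (X.curvature δ (ω + z • φ)) φ x)) _
          (h.d_weilForm_mem (δ := δ) y)))
    convert key using 1
    noncomm_ring

/-- The classes of `W^ω` do not change along a real line of connections which satisfy the splitting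
condition. -/
lemma exists_transgression (hconn : ∀ t : ℝ, X.IsConnection (ω + (t : ℂ) • φ))
    (hs : ∀ t : ℝ, X.Splitting δ (ω + (t : ℂ) • φ)) {x : TensorAlgebra ℂ C.inv}
    (hx : x ∈ C.invariants) :
    ∃ η ∈ X.baseForms, X.weilForm δ (ω + φ) x - X.weilForm δ ω x = X.gd.d η := by
  have h0 : X.IsConnection ω := by simpa using hconn 0
  have h1 : X.IsConnection (ω + φ) := by simpa using hconn 1
  have hφt : X.IsTensorial φ := by simpa using h0.isTensorial_sub h1
  have hφ : X.IsPseudotensorial 1 φ :=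
    ⟨fun ϑ => by simpa using sub_mem (h1.deg_one ϑ) (h0.deg_one ϑ), hφt.wedgeF⟩
  -- As polynomials in `t`, `p` is `W^{ω + tφ}(x)` and `q` is the form whose differential will be
  -- its derivative.
  set p := TensorAlgebra.lift ℂ (X.curvaturePoly δ ω φ) x with hp
  set q := variation (X.curvaturePoly δ ω φ) ((monomial 0).restrictScalars ℂ ∘ₗ φ) x with hq
  have ep (z : ℂ) : evalScalar z p = X.weilForm δ (ω + z • φ) x := by
    rw [hp, map_lift_eq, evalScalar_curvaturePoly]; rfl
  have eq (z : ℂ) : evalScalar z q = variation (X.curvature δ (ω + z • φ)) φ x := by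
    rw [hq, map_variation, evalScalar_curvaturePoly]
    congr 2
    ext ϑ
    simp
  have pb (n : ℕ) : p.coeff n ∈ Subalgebra.toSubmodule X.baseForms :=
    coeff_mem_of_evalScalar_mem _ p
      (fun t => by rw [ep]; exact (hconn t).weilForm_mem_baseForms hx) n
  have qb (n : ℕ) : q.coeff n ∈ Subalgebra.toSubmodule X.baseForms :=
    coeff_mem_of_evalScalar_mem _ q
      (fun t => by
        rw [eq]
        exact mem_baseForms_of_action hx
          ((curvature_isTensorial δ (hconn t)).action_variation hφt x)) n
  have dpb (t : ℝ) : evalScalar (t : ℂ) (derivative p) ∈ Subalgebra.toSubmodule X.baseForms := by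
    rw [evalScalar_eq_sum]
    refine Submodule.sum_mem _ fun n _ => Submodule.smul_mem _ _ ?_
    rw [coeff_derivative]
    exact mul_mem (s := X.baseForms) (pb (n + 1)) (add_mem (natCast_mem _ n) (one_mem _))
  let dq : Polynomial Ω := ∑ n ∈ q.support, monomial n (X.gd.d (q.coeff n))
  have hdq (n : ℕ) : dq.coeff n = X.gd.d (q.coeff n) := by
    simp only [dq, finsetSum_coeff, coeff_monomial, Finset.sum_ite_eq', mem_support_iff]
    by_cases h : q.coeff n = 0 <;> simp [h]
  have edq (z : ℂ) : evalScalar z dq = X.gd.d (evalScalar z q) := by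
    rw [evalScalar_eq_sum z q]
    simp [dq]
  have hcoeff (n : ℕ) : (derivative p).coeff n = X.gd.d (q.coeff n) := by
    -- The ideal `𝒦_{ω + tφ}` varies with `t`, so equality must be obtained at each real `t` before
    -- coefficients are compared. Taking the zero subspace turns vanishing at all real points into
    -- vanishing of the coefficients.
    have h := coeff_mem_of_evalScalar_mem (⊥ : Submodule ℂ Ω) (derivative p - dq) (fun t => by
      rw [Submodule.mem_bot, map_sub, edq]
      refine hs t _ (baseForms_le_hor ?_) ?_
      · refine sub_mem (dpb t) (X.d_mem_baseForms ?_)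
        rw [evalScalar_eq_sum]
        exact Submodule.sum_mem (Subalgebra.toSubmodule X.baseForms)
          fun n _ => Submodule.smul_mem _ _ (qb n)
      · rw [eq]
        exact derivative_sub_mem _ (hconn t) hφ x) n
    rwa [Submodule.mem_bot, coeff_sub, hdq, sub_eq_zero] at h
  have hstep (n : ℕ) : p.coeff (n + 1) = X.gd.d (((n : ℂ) + 1)⁻¹ • q.coeff n) := by
    have hn : ((n : ℂ) + 1) ≠ 0 := Nat.cast_add_one_ne_zero n
    have hc : (n : Ω) + 1 = algebraMap ℂ Ω ((n : ℂ) + 1) := by simp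
    rw [map_smul, ← hcoeff, coeff_derivative, hc, ← Algebra.commutes, ← Algebra.smul_def,
      smul_smul, inv_mul_cancel₀ hn, one_smul]
  -- This is the integral of `q` over `[0, 1]`, truncated at the degree of `p`. Later coefficients
  -- of `q` are closed by `hcoeff`, so leaving them out does not change the differential.
  refine ⟨∑ n ∈ Finset.range p.natDegree, ((n : ℂ) + 1)⁻¹ • q.coeff n,
    Submodule.sum_mem (Subalgebra.toSubmodule X.baseForms)
      fun n _ => Submodule.smul_mem _ _ (qb n), ?_⟩
  have hsum (z : ℂ) : evalScalar z p = ∑ n ∈ Finset.range (p.natDegree + 1), z ^ n • p.coeff n := by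
    conv_lhs => rw [p.as_sum_range]
    simp
  have e1 := ep 1
  have e0 := ep 0
  rw [one_smul] at e1
  rw [zero_smul, add_zero] at e0
  rw [← e1, ← e0, hsum, hsum, Finset.sum_range_succ', Finset.sum_range_succ', map_sum]
  simp [hstep]

end Transgression

end BundleCalculus

end

end QuantumBundle

namespace QuantumBundle

set_option linter.unusedSectionVars false

noncomputable section

/-! ### Compatibility of the adjoint action with the involutions -/

namespace BicovariantCalculus

variable {A Γ : Type*} [Ring A] [HopfAlgebra ℂ A] [StarRing A]
    [StarModule ℂ A] [AddCommGroup Γ] [Module ℂ Γ] [Module A Γ] [Module Aᵐᵒᵖ Γ]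
    [IsScalarTower ℂ A Γ] [IsScalarTower ℂ Aᵐᵒᵖ Γ] [SMulCommClass A Aᵐᵒᵖ Γ]
    [StarAddMonoid Γ] [StarModule ℂ Γ] (C : BicovariantCalculus A Γ) [HopfStarAlgebra A]

/-- In the first factor this is `(a d(b))* = d(b*) a* = d(b* a*) - b* d(a*)`, which avoids the right
module structure. -/
lemma star_actL (X Y : A ⊗[ℂ] A) :
    star (actL A Γ X (C.d.rTensor A Y)) =
      C.d.rTensor A (star Y * star X) - actL A Γ (star Y) (C.d.rTensor A (star X)) := by
  induction X with
  | zero => simp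
  | add X X' h h' =>
    simp only [map_add, LinearMap.add_apply, star_add, h, h', mul_add]; abel
  | tmul x x' =>
    induction Y with
    | zero => simp
    | add Y Y' h h' =>
      simp only [map_add, LinearMap.add_apply, star_add, h, h', add_mul]; abel
    | tmul y y' =>
      simp only [LinearMap.rTensor_tmul, actL_tmul, TensorProduct.star_tmul,
        Algebra.TensorProduct.tmul_mul_tmul, ← TensorProduct.sub_tmul, C.leibniz, C.star_smul_d,
        star_mul, add_sub_cancel_left]

lemma rightAction_star (ξ : Γ) : C.rightAction (star ξ) = star (C.rightAction ξ) := by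
  induction ξ using C.induction with
  | hadd x y hx hy => simp only [star_add, map_add, hx, hy]
  | h a b =>
    have h1 : star (a • C.d b) = (1 : A) • C.d (star b * star a) - star b • C.d (star a) := by
      rw [C.star_smul_d, C.leibniz, one_smul, add_sub_cancel_left]
    rw [h1, map_sub, C.rightAction_smul_d, C.rightAction_smul_d, C.rightAction_smul_d,
      C.star_actL, Bialgebra.comul_mul, HopfStarAlgebra.comul_star,
      HopfStarAlgebra.comul_star, Bialgebra.comul_one]
    congr 1
    generalize C.d.rTensor A _ = Z
    induction Z with
    | zero => simp
    | add Z Z' h h' => simp only [map_add, h, h']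
    | tmul ζ z => rw [Algebra.TensorProduct.one_def, actL_tmul, one_mul, one_smul]

lemma varpi_star (ϑ : C.inv) : C.varpi (star ϑ) = star (C.varpi ϑ) := by
  apply C.inv_rTensor_injective
  rw [C.rTensor_varpi, coe_star_inv, C.rightAction_star, ← C.rTensor_varpi]
  generalize C.varpi ϑ = u
  induction u with
  | zero => simp
  | add u u' h h' => simp only [map_add, star_add, h, h']
  | tmul x a => simp [TensorProduct.star_tmul]

end BicovariantCalculus

section TensorStar

variable {M : Type*} [AddCommGroup M] [Module ℂ M] [StarAddMonoid M] [StarModule ℂ M]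

lemma tensorStar_algebraMap (r : ℂ) :
    tensorStar (algebraMap ℂ (TensorAlgebra ℂ M) r) = algebraMap ℂ _ (star r) := by
  simp only [tensorStar, AddMonoidHom.comp_apply, AddMonoidHom.coe_coe, AlgHom.commutes]
  rfl

/-- The tensor algebra of a space with an antilinear involution as a *-algebra. -/
instance : StarRing (TensorAlgebra ℂ M) where
  star := tensorStar
  star_involutive x := by
    induction x using TensorAlgebra.induction with
    | algebraMap r => rw [tensorStar_algebraMap, tensorStar_algebraMap, star_star]
    | ι m => rw [tensorStar_ι, tensorStar_ι, star_star]
    | add x y hx hy => rw [map_add, map_add, hx, hy]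
    | mul x y hx hy => rw [tensorStar_mul, tensorStar_mul, hx, hy]
  star_add := map_add tensorStar
  star_mul := tensorStar_mul

lemma star_eq_tensorStar (x : TensorAlgebra ℂ M) : star x = tensorStar x := rfl

instance : StarModule ℂ (TensorAlgebra ℂ M) where
  star_smul := tensorStar_smul

end TensorStar

namespace BicovariantCalculus

variable {A Γ : Type*} [Ring A] [HopfAlgebra ℂ A] [StarRing A]
    [StarModule ℂ A] [AddCommGroup Γ] [Module ℂ Γ] [Module A Γ] [Module Aᵐᵒᵖ Γ]
    [IsScalarTower ℂ A Γ] [IsScalarTower ℂ Aᵐᵒᵖ Γ] [SMulCommClass A Aᵐᵒᵖ Γ]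
    [StarAddMonoid Γ] [StarModule ℂ Γ] (C : BicovariantCalculus A Γ) [HopfStarAlgebra A]

lemma varpiT_star (x : TensorAlgebra ℂ C.inv) : C.varpiT (star x) = star (C.varpiT x) := by
  induction x using TensorAlgebra.induction with
  | algebraMap r =>
    rw [star_eq_tensorStar, tensorStar_algebraMap, AlgHom.commutes, AlgHom.commutes,
      Algebra.algebraMap_eq_smul_one, Algebra.algebraMap_eq_smul_one, StarModule.star_smul,
      star_one]
  | ι m =>
    rw [star_eq_tensorStar, tensorStar_ι, varpiT, TensorAlgebra.lift_ι_apply,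
      TensorAlgebra.lift_ι_apply, LinearMap.comp_apply, LinearMap.comp_apply, varpi_star]
    generalize C.varpi m = u
    induction u with
    | zero => simp
    | add u u' h h' => simp only [map_add, star_add, h, h']
    | tmul x a =>
      simp only [TensorProduct.star_tmul, LinearMap.rTensor_tmul, star_eq_tensorStar, tensorStar_ι]
  | add x y hx hy => rw [star_add, map_add, map_add, star_add, hx, hy]
  | mul x y hx hy => rw [star_mul, map_mul, map_mul, star_mul, hx, hy]

lemma tensorStar_mem_invariants {x : TensorAlgebra ℂ C.inv} (hx : x ∈ C.invariants) :
    tensorStar x ∈ C.invariants := by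
  have h : C.varpiT x = x ⊗ₜ 1 := hx
  change C.varpiT (star x) = star x ⊗ₜ 1
  rw [varpiT_star, h, TensorProduct.star_tmul, star_one]

end BicovariantCalculus

/-- The hypothesis on `x` does not pass to its homogeneous components. The identity is therefore
shown for `x + sgn x`, twice the even part of an arbitrary `x`, where odd components cancel, and is
then divided by two. -/
lemma GDStarAlgebra.star_mul_of_even {Ω : Type*} [Ring Ω] [Algebra ℂ Ω] [StarAddMonoid Ω]
    [StarModule ℂ Ω] (S : GDStarAlgebra Ω) {x : Ω} (hx : S.sgn x = x) (y : Ω) :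
    star (x * y) = star y * star x := by
  have key : ∀ x : Ω, star ((x + S.sgn x) * y) = star y * star (x + S.sgn x) := by
    intro x
    induction x using graded_induction S.deg with
    | hadd x x' h h' =>
      have e : x + x' + S.sgn (x + x') = (x + S.sgn x) + (x' + S.sgn x') := by
        rw [map_add]; abel
      rw [e, add_mul, star_add, h, h', star_add _ (x' + _), mul_add]
    | h p x hx =>
      rw [S.sgn_of_mem hx]
      rcases Nat.even_or_odd p with hp | hp
      · induction y using graded_induction S.deg with
        | hadd y y' h h' => rw [mul_add, star_add, h, h', star_add y, add_mul]
        | h q y hy =>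
          have hm : x + (-1 : ℂ) ^ p • x ∈ S.deg p := add_mem hx (Submodule.smul_mem _ _ hx)
          rw [S.star_mul p q _ hm _ hy, (hp.mul_right q).neg_one_pow, one_smul]
      · rw [hp.neg_one_pow]; simp
  have h := key x
  rw [hx, ← two_smul ℂ, smul_mul_assoc, StarModule.star_smul, StarModule.star_smul,
    mul_smul_comm] at h
  exact smul_right_injective Ω (by simp : star (2 : ℂ) ≠ 0) h

/-! ### Hermiticity of the curvature and the Weil homomorphism -/

namespace BundleCalculus

variable {A Γ V B Ω : Type*} [Ring A] [HopfAlgebra ℂ A] [StarRing A]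
    [StarModule ℂ A] [AddCommGroup Γ] [Module ℂ Γ] [Module A Γ] [Module Aᵐᵒᵖ Γ]
    [IsScalarTower ℂ A Γ] [IsScalarTower ℂ Aᵐᵒᵖ Γ] [SMulCommClass A Aᵐᵒᵖ Γ]
    [StarAddMonoid Γ] [StarModule ℂ Γ]
    [Ring V] [Algebra ℂ V] [StarRing V] [StarModule ℂ V]
    [Ring B] [Algebra ℂ B] [StarRing B] [StarModule ℂ B]
    {C : BicovariantCalculus A Γ} {P : QuantumPrincipalBundle A V B}
    [Ring Ω] [Algebra ℂ Ω] [StarAddMonoid Ω] [StarModule ℂ Ω] {X : BundleCalculus C P Ω}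
    [HopfStarAlgebra A] {δ : EmbeddedDifferential C} {ω : C.inv →ₗ[ℂ] Ω}

/-- The sign in the hermiticity of `δ` cancels the sign of the graded involution on a product of two
one-forms. -/
lemma IsConnection.curvature_star (h : X.IsConnection ω) (ϑ : C.inv) :
    X.curvature δ ω (star ϑ) = star (X.curvature δ ω ϑ) := by
  have hb : bracket δ ω ω (star ϑ) = star (bracket δ ω ω ϑ) := by
    simp only [bracket, LinearMap.comp_apply, δ.hermitian]
    generalize δ.δ ϑ = z
    induction z with
    | zero => simp
    | add x y hx hy => simp only [map_add, star_add, neg_add, hx, hy]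
    | tmul α β =>
      simp only [TensorProduct.star_tmul, map_neg, TensorProduct.comm_tmul, TensorProduct.map_tmul,
        LinearMap.mul'_apply, h.hermitian, X.gd.star_mul 1 1 _ (h.deg_one α) _ (h.deg_one β)]
      simp
  simp only [curvature, LinearMap.sub_apply, LinearMap.comp_apply, star_sub, hb, h.hermitian,
    X.gd.star_d]

/-- On even forms the graded involution is antimultiplicative without signs, which matches the
unsigned involution of the tensor algebra. -/
lemma IsConnection.weilForm_star (h : X.IsConnection ω) (x : TensorAlgebra ℂ C.inv) :
    X.weilForm δ ω (star x) = star (X.weilForm δ ω x) := by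
  induction x using TensorAlgebra.induction with
  | algebraMap r =>
    -- That the involution fixes the unit is not an axiom; it follows by applying
    -- antimultiplicativity to `1 · 1*`.
    have h1 : star (1 : Ω) = 1 := by
      have h2 := X.gd.star_mul_of_even
        (by simpa using X.gd.sgn_of_mem (SetLike.GradedOne.one_mem (A := X.gd.deg))) (star 1)
      simpa using h2.symm
    rw [star_eq_tensorStar, tensorStar_algebraMap, AlgHom.commutes, AlgHom.commutes,
      Algebra.algebraMap_eq_smul_one, Algebra.algebraMap_eq_smul_one, StarModule.star_smul, h1]
  | ι m =>
    rw [star_eq_tensorStar, tensorStar_ι, weilForm, TensorAlgebra.lift_ι_apply,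
      TensorAlgebra.lift_ι_apply, h.curvature_star]
  | add x y hx hy => rw [star_add, map_add, map_add, star_add, hx, hy]
  | mul x y hx hy =>
    rw [star_mul, map_mul, map_mul, X.gd.star_mul_of_even (h.sgn_weilForm x), hx, hy]

lemma cls_eq_cls {x y : X.cocycles} (h : ∃ η ∈ X.baseForms, (x : Ω) - y = X.gd.d η) :
    X.cls x = X.cls y := by
  obtain ⟨η, hη, h⟩ := h
  exact Ideal.Quotient.eq.2 ⟨η, hη, h.symm⟩

variable (δ) in
/-- The Weil homomorphism of a connection. -/
def IsConnection.weilHom (h : X.IsConnection ω) (hs : X.Splitting δ ω) :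
    C.invariants →ₐ[ℂ] X.Cohomology :=
  X.cls.comp (((X.weilForm δ ω).comp C.invariants.val).codRestrict X.cocycles
    (fun ϑ => ⟨h.weilForm_mem_baseForms ϑ.2, h.d_weilForm hs ϑ.2⟩))

end BundleCalculus

end

end QuantumBundle

/-! ### The Weil homomorphism of an affine space of connections -/

theorem mainTheorem1 {A Γ V B Ω : Type*} [Ring A] [HopfAlgebra ℂ A] [StarRing A]
    [StarModule ℂ A] [HopfStarAlgebra A]
    [AddCommGroup Γ] [Module ℂ Γ] [Module A Γ] [Module Aᵐᵒᵖ Γ]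
    [IsScalarTower ℂ A Γ] [IsScalarTower ℂ Aᵐᵒᵖ Γ] [SMulCommClass A Aᵐᵒᵖ Γ]
    [StarAddMonoid Γ] [StarModule ℂ Γ]
    [Ring V] [Algebra ℂ V] [StarRing V] [StarModule ℂ V]
    [Ring B] [Algebra ℂ B] [StarRing B] [StarModule ℂ B]
    [Ring Ω] [Algebra ℂ Ω] [StarAddMonoid Ω] [StarModule ℂ Ω]
    (C : BicovariantCalculus A Γ) (P : QuantumPrincipalBundle A V B) (X : BundleCalculus C P Ω)
    (δ : EmbeddedDifferential C)
    (𝒳 : AffineSubspace ℝ (C.inv →ₗ[ℂ] Ω)) (hne : (𝒳 : Set (C.inv →ₗ[ℂ] Ω)).Nonempty)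
    (hconn : ∀ ω ∈ 𝒳, X.IsConnection ω) (hsplit : ∀ ω ∈ 𝒳, X.Splitting δ ω) :
    (∀ ω ∈ 𝒳, ∀ ϑ ∈ C.invariants,
      X.weilForm δ ω ϑ ∈ X.baseForms ∧ X.gd.d (X.weilForm δ ω ϑ) = 0) ∧
    (∀ ω ∈ 𝒳, ∀ τ ∈ 𝒳, ∀ ϑ ∈ C.invariants, ∃ η ∈ X.baseForms,
      X.weilForm δ ω ϑ - X.weilForm δ τ ϑ = X.gd.d η) ∧
    ∃ W : C.invariants →ₐ[ℂ] X.Cohomology,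
      (∀ ω ∈ 𝒳, ∀ ϑ : C.invariants, ∃ h : X.weilForm δ ω ϑ ∈ X.cocycles,
        W ϑ = X.cls ⟨X.weilForm δ ω ϑ, h⟩) ∧
      (∀ ϑ : C.invariants, ∃ h : tensorStar (ϑ : TensorAlgebra ℂ C.inv) ∈ C.invariants,
        W ⟨tensorStar (ϑ : TensorAlgebra ℂ C.inv), h⟩ = X.starH (W ϑ)) := by
  -- Only real parameters stay in `𝒳`, which is why the polynomial arguments use values at real
  -- points alone.
  have hline : ∀ ω ∈ 𝒳, ∀ τ ∈ 𝒳, ∀ t : ℝ, τ + (t : ℂ) • (ω - τ) ∈ 𝒳 := by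
    intro ω hω τ hτ t
    have h := AffineMap.lineMap_mem t hτ hω
    rw [AffineMap.lineMap_apply_module', add_comm] at h
    exact h
  have htr : ∀ ω ∈ 𝒳, ∀ τ ∈ 𝒳, ∀ ϑ ∈ C.invariants, ∃ η ∈ X.baseForms,
      X.weilForm δ ω ϑ - X.weilForm δ τ ϑ = X.gd.d η := by
    intro ω hω τ hτ ϑ hϑ
    have h := BundleCalculus.exists_transgression (fun t => hconn _ (hline ω hω τ hτ t))
      (fun t => hsplit _ (hline ω hω τ hτ t)) hϑ
    rwa [add_sub_cancel] at h
  -- A single base connection defines `W`; transgression identifies its classes with those of every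
  -- other connection, and the *-property holds already for forms at `ω₀`.
  obtain ⟨ω₀, hω₀⟩ := hne
  refine ⟨fun ω hω ϑ hϑ => ⟨(hconn ω hω).weilForm_mem_baseForms hϑ,
    (hconn ω hω).d_weilForm (hsplit ω hω) hϑ⟩, htr,
    (hconn ω₀ hω₀).weilHom δ (hsplit ω₀ hω₀), fun ω hω ϑ =>
      ⟨⟨(hconn ω hω).weilForm_mem_baseForms ϑ.2, (hconn ω hω).d_weilForm (hsplit ω hω) ϑ.2⟩,
        BundleCalculus.cls_eq_cls (htr ω₀ hω₀ ω hω ϑ ϑ.2)⟩,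
    fun ϑ => ⟨C.tensorStar_mem_invariants ϑ.2, ?_⟩⟩
  exact congrArg X.cls (Subtype.ext ((hconn ω₀ hω₀).weilForm_star (ϑ : TensorAlgebra ℂ C.inv)))
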